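/- Let $f_0,f_1$ be holomorphic functions near $0\in\mathbb C$, not both identically zero near $0$, and consider the complex second order ODE $$y''=f_0(y)(y-xy')^3+f_1(y)\,y'\,(y-xy')^2 \qquad (*)$$ near the reference point $(x,y,y')=(0,0,0)$. It admits the shear $y\,\partial_x$ as an infinitesimal symmetry. Two ODEs $y''=B(x,y,y')$ are called equivalent if there is a local biholomorphism of $(\mathbb C^2,0)$ whose lift to the coordinates $(x,y,p)$, $p=y'$, fixes $(0,0,0)$ and which takes one ODE to the other near this point. A holomorphic infinitesimal symmetry $V=\xi\,\partial_x+\eta\,\partial_y$, defined near $(0,0)$, is called non-isotropic if its lift to the coordinates $(x,y,p)$ does not vanish at $(0,0,0)$. Suppose that $(*)$ admits, in addition to the shear, a non-isotropic infinitesimal symmetry $V$. 1. If $V(0,0)\neq 0$, then there is an integer $j\ge 0$ such that, for every $c\in\mathbb C\setminus\{0\}$, $(*)$ is equivalent to $$y''=y^j\,(y-(x-c)y')^3,$$ or there are an integer $j\ge 0$ and $C\in\mathbb C$ such that, for every $c\in\mathbb C\setminus\{0\}$, $(*)$ is equivalent to $$y''=y^j\,y'\,(y-(x-c)y')^2+C\,y^{2j+2}\,(y-(x-c)y')^3.$$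 2. If $V(0,0)=0$, then $(*)$ is equivalent to $y''=(y-xy')^3$, which is the first of these ODEs with $j=0$ and $c=0$. -/

import Mathlib

open Filter Topology

/-! Points of the plane `ℂ × ℂ` are `(x, y)`; points of the three-dimensional space of 1-jets
`ℂ × ℂ × ℂ` are `q = (x, y, p)`, with `p` standing for `y' = dy/dx`.  The second order ODE
`y'' = B(x, y, y')` is given by its right-hand side `B`, regarded as a germ at `(0, 0, 0)`. -/

/-- The projection `(x, y, p) ↦ (x, y)`. -/
def basePt (q : ℂ × ℂ × ℂ) : ℂ × ℂ := (q.1, q.2.1)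

/-- The total derivative `F_x + p F_y + B F_p` of a function `F(x, y, p)` along the solutions of
`y'' = B(x, y, y')`. -/
noncomputable def totalDeriv (B F : ℂ × ℂ × ℂ → ℂ) (q : ℂ × ℂ × ℂ) : ℂ :=
  fderiv ℂ F q (1, q.2.2, B q)

/-- For a map `G` on the plane, the total derivative `G_x + p G_y` (taken componentwise). -/
noncomputable def planeDeriv (G : ℂ × ℂ → ℂ × ℂ) (q : ℂ × ℂ × ℂ) : ℂ × ℂ :=
  fderiv ℂ G (basePt q) (1, q.2.2)

/-- The first prolongation `ξ ∂_x + η ∂_y + (D η - p D ξ) ∂_p` of the vector field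
`V = ξ ∂_x + η ∂_y` to the space of 1-jets, where `D = ∂_x + p ∂_y`. -/
noncomputable def prolong (V : ℂ × ℂ → ℂ × ℂ) (q : ℂ × ℂ × ℂ) : ℂ × ℂ × ℂ :=
  ((V (basePt q)).1, (V (basePt q)).2, (planeDeriv V q).2 - q.2.2 * (planeDeriv V q).1)

/-- `V = ξ ∂_x + η ∂_y` is (the germ at the origin of) a holomorphic infinitesimal symmetry of
`y'' = B(x, y, y')`: its second prolongation, whose last coefficient on the equation is
`D(η₁) - B D(ξ)` with `η₁` the `∂_p`-coefficient of the first prolongation, is tangent to the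
hypersurface `y'' = B(x, y, p)`. -/
def IsInfinitesimalSymmetry (B : ℂ × ℂ × ℂ → ℂ) (V : ℂ × ℂ → ℂ × ℂ) : Prop :=
  AnalyticAt ℂ V 0 ∧
    ∀ᶠ q in 𝓝 (0 : ℂ × ℂ × ℂ),
      totalDeriv B (fun r => (prolong V r).2.2) q - B q * (planeDeriv V q).1
        = fderiv ℂ B q (prolong V q)

/-- A vector field is isotropic if (its lift to the space of 1-jets) vanishes at the reference
point `(x, y, p) = (0, 0, 0)`. -/
def IsIsotropic (V : ℂ × ℂ → ℂ × ℂ) : Prop :=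
  prolong V 0 = 0

/-- The lift `(x, y, p) ↦ (f, g, D g / D f)`, `D = ∂_x + p ∂_y`, of the point transformation
`Φ = (f, g)` to the space of 1-jets. -/
noncomputable def liftMap (Φ : ℂ × ℂ → ℂ × ℂ) (q : ℂ × ℂ × ℂ) : ℂ × ℂ × ℂ :=
  ((Φ (basePt q)).1, (Φ (basePt q)).2, (planeDeriv Φ q).2 / (planeDeriv Φ q).1)

/-- Equivalence of the germs at `(0, 0, 0)` of the ODEs `y'' = B(x, y, y')` and
`y'' = B'(x, y, y')`: there is a local biholomorphism `Φ = (f, g)` of `(ℂ², 0)` whose lift fixes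
the reference point `(0, 0, 0)` (that is, `Φ 0 = 0` and `g_x(0) = 0`) and which takes the first ODE
to the second one: with `P = D g / D f` the transformed slope, `D P = B'(f, g, P) D f` along the
solutions of the first ODE. -/
def ODEEquivalent (B B' : ℂ × ℂ × ℂ → ℂ) : Prop :=
  ∃ Φ : ℂ × ℂ → ℂ × ℂ,
    AnalyticAt ℂ Φ 0 ∧ Φ 0 = 0 ∧ Function.Bijective (fderiv ℂ Φ 0) ∧
    (fderiv ℂ Φ 0 (1, 0)).2 = 0 ∧
    ∀ᶠ q in 𝓝 (0 : ℂ × ℂ × ℂ),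
      totalDeriv B (fun r => (liftMap Φ r).2.2) q = B' (liftMap Φ q) * (planeDeriv Φ q).1

/-- The shear-invariant ODE `y'' = f₀(y) (y - x y')³ + f₁(y) y' (y - x y')²`. -/
def shearODE (f₀ f₁ : ℂ → ℂ) (q : ℂ × ℂ × ℂ) : ℂ :=
  f₀ q.2.1 * (q.2.1 - q.1 * q.2.2) ^ 3 + f₁ q.2.1 * q.2.2 * (q.2.1 - q.1 * q.2.2) ^ 2

/-- The `x`-shift by `c`: the ODE `y'' = B(x - c, y, y')`. -/
def xShift (c : ℂ) (B : ℂ × ℂ × ℂ → ℂ) (q : ℂ × ℂ × ℂ) : ℂ :=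
  B (q.1 - c, q.2.1, q.2.2)

/-- The first series: `y'' = y ^ j (y - x y')³`. -/
def firstSeries (j : ℕ) (q : ℂ × ℂ × ℂ) : ℂ :=
  q.2.1 ^ j * (q.2.1 - q.1 * q.2.2) ^ 3

/-- The second series: `y'' = y ^ j y' (y - x y')² + C y ^ (2 j + 2) (y - x y')³`. -/
def secondSeries (j : ℕ) (C : ℂ) (q : ℂ × ℂ × ℂ) : ℂ :=
  q.2.1 ^ j * q.2.2 * (q.2.1 - q.1 * q.2.2) ^ 2
    + C * q.2.1 ^ (2 * j + 2) * (q.2.1 - q.1 * q.2.2) ^ 3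

/-!
The solutions of the shear-invariant equation include the lines through the origin, since its
right-hand side is divisible by `(y - x y')²`. A symmetry `V = ξ ∂_x + η ∂_y` is therefore strongly
restricted. Its determining equations (`eventually_determiningEqs`) combine to
`(E - 1)(E - 2)(x η - y ξ) = 0`, where `E = x ∂_x + y ∂_y`, so that `x η - y ξ` has only linear and
quadratic terms (`eq_quadratic_of_eulerOp_eq_zero`). A second combination is an inhomogeneous
equation of the same kind for `η`, and it follows that `ξ` is quadratic and `η` affine in `x`, with
coefficients given by a second primitive of `2 f₁` and a few constants (`exists_symmetry_form`).

The commutator of `V` with the shear `y ∂_x` is then, up to a multiple of the shear, of the form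
`(x (a + e(y)) - b) ∂_x + y e(y) ∂_y`, and so is `V` itself if it is tangent to `y = 0` at the origin
without vanishing there (`exists_affineSymmetry`). Such a field imposes on `f₀`, `f₁` the equations
collected in `AffineSymmetry`, with `b ≠ 0` if `V(0) ≠ 0`, and with `b = 0`, `a = -2 e(0) ≠ 0` if
`V(0) = 0` and `V` is non-isotropic.

Comparing lowest order terms shows that `e(0) ≠ 0` when `b ≠ 0`, and that `a = -(l + 1) e(0)` for
some `l ≥ 1` (`AffineSymmetry.e_ne_zero`, `AffineSymmetry.exists_eigenvalue`). Hence there is no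
resonance, and a transformation `(X, Y) = (x m(y) + h(y), y m(y))` takes the field to the linear one
`e(0) (Y ∂_Y - l X ∂_X)`; the origin goes to `(h(0), 0)`, which is where the shift in `x` comes from.
The same transformation preserves the shape of the equation
(`AffineSymmetry.exists_normalizing`, `IsNormalizing.odeEquivalent`). The new coefficients are
eigenfunctions of `Y ∂_Y`, that is, monomials `E₀ Y ^ (2 l - 2)` and `E₁ Y ^ (l - 2)`. Scaling `x`
and `y` normalizes `E₁`, or `E₀` if `E₁ = 0`, and the shift in `x`, which is nonzero exactly when
`b ≠ 0` (`AffineSymmetry.odeEquivalent`). For `V(0) = 0` one has `l = 1`, which leaves only `(Y - X Y')³`.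
-/

/-! ### Germs of holomorphic functions of one variable -/

theorem analyticAt_eventuallyEq_of_mul_left {f g k : ℂ → ℂ} {a : ℂ} (hf : AnalyticAt ℂ f a)
    (hg : AnalyticAt ℂ g a) (hk : ∀ᶠ y in 𝓝[≠] a, k y ≠ 0)
    (h : ∀ᶠ y in 𝓝 a, k y * f y = k y * g y) : ∀ᶠ y in 𝓝 a, f y = g y := by
  apply (hf.frequently_eq_iff_eventually_eq hg).1
  apply Eventually.frequently
  filter_upwards [hk, h.filter_mono nhdsWithin_le_nhds] with y hy h1
  exact mul_left_cancel₀ hy h1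

theorem analyticAt_eventuallyEq_of_id_mul {f g : ℂ → ℂ} (hf : AnalyticAt ℂ f 0)
    (hg : AnalyticAt ℂ g 0) (h : ∀ᶠ y in 𝓝 (0 : ℂ), y * f y = y * g y) :
    ∀ᶠ y in 𝓝 (0 : ℂ), f y = g y :=
  analyticAt_eventuallyEq_of_mul_left hf hg self_mem_nhdsWithin h

/-- Germs of holomorphic functions form an integral domain. -/
theorem analyticAt_eventuallyEq_zero_or {f g : ℂ → ℂ} {a : ℂ} (hf : AnalyticAt ℂ f a)
    (hg : AnalyticAt ℂ g a) (h : ∀ᶠ y in 𝓝 a, f y * g y = 0) :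
    (∀ᶠ y in 𝓝 a, f y = 0) ∨ ∀ᶠ y in 𝓝 a, g y = 0 := by
  rcases hf.eventually_eq_zero_or_eventually_ne_zero with h1 | h1
  · exact Or.inl h1
  · right
    apply analyticAt_eventuallyEq_of_mul_left hg analyticAt_const h1
    simpa using h

theorem analyticAt_eventually_zero_of_pow_mul {g : ℂ → ℂ} (hg : AnalyticAt ℂ g 0) (n : ℕ)
    (h : ∀ᶠ y in 𝓝 (0 : ℂ), y ^ n * g y = 0) : ∀ᶠ y in 𝓝 (0 : ℂ), g y = 0 :=
  analyticAt_eventuallyEq_of_mul_left (k := fun y => y ^ n) hg analyticAt_const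
    (eventually_mem_nhdsWithin.mono fun _ hy => pow_ne_zero n hy)
    (h.mono fun y hy => by rw [hy, mul_zero])

theorem eq_of_deriv_eq_zero_ball {F : ℂ → ℂ} {a : ℂ} {r : ℝ}
    (h : ∀ t ∈ Metric.ball a r, HasDerivAt F 0 t) {t : ℂ} (ht : t ∈ Metric.ball a r) :
    F t = F a := by
  have hr : 0 < r := dist_nonneg.trans_lt ht
  refine (convex_ball a r).is_const_of_fderivWithin_eq_zero (𝕜 := ℂ) (f := F)
    (fun s hs => (h s hs).differentiableAt.differentiableWithinAt) (fun s hs => ?_) ht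
    (Metric.mem_ball_self hr)
  rw [fderivWithin_of_isOpen Metric.isOpen_ball hs]
  ext
  simpa using (h s hs).deriv

theorem eventually_eq_of_deriv_eq_zero {g : ℂ → ℂ} {a : ℂ} (hg : AnalyticAt ℂ g a)
    (h : ∀ᶠ y in 𝓝 a, deriv g y = 0) : ∀ᶠ y in 𝓝 a, g y = g a := by
  obtain ⟨r, hr, hb⟩ := Metric.eventually_nhds_iff_ball.1 (h.and hg.eventually_analyticAt)
  filter_upwards [Metric.ball_mem_nhds a hr] with y hy
  exact eq_of_deriv_eq_zero_ball
    (fun t ht => (hb t ht).1 ▸ (hb t ht).2.differentiableAt.hasDerivAt) hy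

/-- The Euler operator `y d/dy + l` with `l ≥ 1` is onto on germs of holomorphic functions: it
multiplies the `n`-th Taylor coefficient by `n + l`, which stays away from zero. -/
theorem exists_analyticAt_euler_eq {f : ℂ → ℂ} (hf : AnalyticAt ℂ f 0) {l : ℝ} (hl : 1 ≤ l) :
    ∃ h : ℂ → ℂ, AnalyticAt ℂ h 0 ∧
      ∀ᶠ y in 𝓝 (0 : ℂ), y * deriv h y + (l : ℂ) * h y = f y := by
  obtain ⟨p, r, hp⟩ := hf
  let q : FormalMultilinearSeries ℂ ℂ ℂ := fun n => ((n : ℂ) + (l : ℂ))⁻¹ • p n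
  have hnl : ∀ n : ℕ, 1 ≤ ‖(n : ℂ) + (l : ℂ)‖ := fun n => by
    have : (n : ℂ) + (l : ℂ) = (((n : ℝ) + l : ℝ) : ℂ) := by push_cast; ring
    rw [this, Complex.norm_real, Real.norm_of_nonneg (by positivity)]
    have : (0 : ℝ) ≤ n := n.cast_nonneg
    linarith
  have hle : p.radius ≤ q.radius := by
    refine FormalMultilinearSeries.radius_le_of_le fun n => ?_
    simp only [q, norm_smul, norm_inv]
    exact mul_le_of_le_one_left (norm_nonneg _) (inv_le_one_of_one_le₀ (hnl n))
  have hq : HasFPowerSeriesOnBall q.sum q 0 r :=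
    (q.hasFPowerSeriesOnBall (hp.r_pos.trans_le (hp.r_le.trans hle))).mono hp.r_pos
      (hp.r_le.trans hle)
  refine ⟨q.sum, hq.analyticAt, ?_⟩
  filter_upwards [Metric.eball_mem_nhds (0 : ℂ) hp.r_pos] with y hy
  have h1 := hp.hasSum hy
  have h2 := hq.hasSum hy
  have h3 := (hq.fderiv.hasSum hy).mapL (ContinuousLinearMap.apply ℂ ℂ y)
  simp only [ContinuousLinearMap.apply_apply, FormalMultilinearSeries.derivSeries_apply_diag,
    zero_add] at h1 h2 h3
  have h4 : HasSum (fun n : ℕ => n • q n fun _ => y) (fderiv ℂ q.sum y y) := by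
    have := (hasSum_nat_add_iff (f := fun n : ℕ => n • q n fun _ => y) 1).1 h3
    simpa using this
  have h5 := h4.add (h2.mul_left (l : ℂ))
  have h6 : fderiv ℂ q.sum y y = y * deriv q.sum y := by
    rw [fderiv_eq_smul_deriv, smul_eq_mul]
  rw [h6] at h5
  have h7 : ∀ n : ℕ, p n (fun _ => y) = n • q n (fun _ => y) + (l : ℂ) * q n fun _ => y := by
    intro n
    have : (n : ℂ) + (l : ℂ) ≠ 0 := fun h0 => by
      have := hnl n
      rw [h0, norm_zero] at this
      linarith
    simp only [q, _root_.smul_apply, smul_eq_mul, nsmul_eq_mul]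
    field_simp
  refine h5.unique ?_
  simpa only [h7] using h1

theorem exists_analyticAt_primitive {f : ℂ → ℂ} (hf : AnalyticAt ℂ f 0) :
    ∃ h : ℂ → ℂ, AnalyticAt ℂ h 0 ∧ h 0 = 0 ∧ ∀ᶠ y in 𝓝 (0 : ℂ), HasDerivAt h (f y) y := by
  obtain ⟨h, hh, he⟩ := exists_analyticAt_euler_eq hf le_rfl
  refine ⟨fun y => y * h y, analyticAt_id.mul hh, by simp, ?_⟩
  filter_upwards [he, hh.eventually_analyticAt] with y hy ha
  refine ((hasDerivAt_id y).mul ha.differentiableAt.hasDerivAt).congr_deriv ?_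
  rw [← hy]; simp; ring

/-- A nonzero germ `g` with `y A(y) g' = B(y) g` vanishes at the origin to the order `N` given by
`N A(0) = B(0)`: compare the lowest order terms. -/
theorem eventually_eq_zero_or_order_eq {g A B : ℂ → ℂ} (hg : AnalyticAt ℂ g 0)
    (hA : ContinuousAt A 0) (hB : ContinuousAt B 0)
    (h : ∀ᶠ y in 𝓝 (0 : ℂ), y * A y * deriv g y = B y * g y) :
    (∀ᶠ y in 𝓝 (0 : ℂ), g y = 0) ∨
      ∃ (N : ℕ) (k : ℂ → ℂ), AnalyticAt ℂ k 0 ∧ k 0 ≠ 0 ∧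
        (∀ᶠ y in 𝓝 (0 : ℂ), g y = y ^ N * k y) ∧ N * A 0 = B 0 := by
  by_cases h0 : ∀ᶠ y in 𝓝 (0 : ℂ), g y = 0
  · exact Or.inl h0
  right
  obtain ⟨N, k, hk, hk0, he⟩ := hg.exists_eventuallyEq_pow_smul_nonzero_iff.2 h0
  simp only [sub_zero, smul_eq_mul] at he
  refine ⟨N, k, hk, hk0, he, ?_⟩
  have h1 : ∀ᶠ y in 𝓝[≠] (0 : ℂ), A y * (N * k y + y * deriv k y) - B y * k y = 0 := by
    filter_upwards [h.filter_mono nhdsWithin_le_nhds,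
      he.eventually_nhds.filter_mono nhdsWithin_le_nhds,
      hk.eventually_analyticAt.filter_mono nhdsWithin_le_nhds, self_mem_nhdsWithin]
      with y h1 h2 h3 hy
    have h4 : deriv g y = N * y ^ (N - 1) * k y + y ^ N * deriv k y := by
      rw [EventuallyEq.deriv_eq h2]
      exact ((hasDerivAt_pow N y).mul h3.differentiableAt.hasDerivAt).deriv
    have h5 : y * (N * y ^ (N - 1) : ℂ) = N * y ^ N := by
      rcases N with _ | N
      · simp
      · simp [pow_succ]; ring
    have h6 : y ^ N ≠ 0 := pow_ne_zero _ hy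
    rw [h4, h2.self_of_nhds] at h1
    apply mul_left_cancel₀ h6
    linear_combination h1 - A y * k y * h5
  have h2 : ContinuousAt (fun y => A y * (N * k y + y * deriv k y) - B y * k y) 0 := by
    have := hk.continuousAt
    have := hk.deriv.continuousAt
    fun_prop
  have h3 := tendsto_nhds_unique (h2.tendsto.mono_left nhdsWithin_le_nhds)
    (tendsto_const_nhds.congr' (h1.mono fun y hy => hy.symm))
  apply mul_right_cancel₀ hk0
  simp only [zero_mul, add_zero] at h3
  linear_combination h3

theorem eventually_eq_zero_of_euler_eq_zero {u : ℂ → ℂ} {n : ℕ} (hn : 0 < n)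
    (hu : AnalyticAt ℂ u 0) (h : ∀ᶠ y in 𝓝 (0 : ℂ), y * deriv u y + n * u y = 0) :
    ∀ᶠ y in 𝓝 (0 : ℂ), u y = 0 := by
  have h' : ∀ᶠ y in 𝓝 (0 : ℂ), y * (fun _ => 1 : ℂ → ℂ) y * deriv u y
      = (fun _ => -n : ℂ → ℂ) y * u y := by
    filter_upwards [h] with y hy
    linear_combination hy
  rcases eventually_eq_zero_or_order_eq hu continuousAt_const continuousAt_const h' with
    h | ⟨N, _, _, _, _, hN⟩
  · exact h
  · have : ((N + n : ℕ) : ℂ) = 0 := by push_cast; linear_combination hN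
    have : N + n = 0 := by exact_mod_cast this
    omega

/-! ### Linearization and regular singular equations -/

theorem exists_eq_add_id_mul {f : ℂ → ℂ} (hf : AnalyticAt ℂ f 0) :
    ∃ g : ℂ → ℂ, AnalyticAt ℂ g 0 ∧ ∀ y, f y = f 0 + y * g y := by
  refine ⟨dslope f 0, ?_, fun y => ?_⟩
  · obtain ⟨p, hp⟩ := hf
    exact hp.has_fpower_series_dslope_fslope.analyticAt
  · have := sub_smul_dslope f 0 y
    simp only [sub_zero, smul_eq_mul] at this
    rw [this]; ring

/-- Linearization of the vector field `y ε(y) ∂_y`: the coordinate `Y = y m(y)` satisfies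
`y ε Y' = ε(0) Y`. -/
theorem exists_linearizing_factor {e : ℂ → ℂ} (he : AnalyticAt ℂ e 0) (he0 : e 0 ≠ 0) :
    ∃ m : ℂ → ℂ, AnalyticAt ℂ m 0 ∧ m 0 = 1 ∧
      ∀ᶠ y in 𝓝 (0 : ℂ), e y * (m y + y * deriv m y) = e 0 * m y := by
  obtain ⟨g, hg, hge⟩ := exists_eq_add_id_mul he
  obtain ⟨G, hG, hG0, hG'⟩ := exists_analyticAt_primitive (hg.neg.div he he0)
  refine ⟨fun y => Complex.exp (G y), hG.cexp, by simp [hG0], ?_⟩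
  filter_upwards [hG', he.continuousAt.eventually_ne he0] with y h1 h2
  rw [h1.cexp.deriv]
  have h3 : e y * ((-g / e) y) = - g y := by
    simp only [Pi.div_apply, Pi.neg_apply]; field_simp
  linear_combination Complex.exp (G y) * y * h3 + Complex.exp (G y) * hge y

/-- A linear equation with a regular singular point and no resonance has a holomorphic solution:
an integrating factor turns it into the equation of the Euler operator. -/
theorem exists_analyticAt_regular_singular {A r : ℂ → ℂ} (hA : AnalyticAt ℂ A 0) (hA0 : A 0 ≠ 0)
    (hr : AnalyticAt ℂ r 0) {l : ℝ} (hl : 1 ≤ l) :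
    ∃ h : ℂ → ℂ, AnalyticAt ℂ h 0 ∧
      ∀ᶠ y in 𝓝 (0 : ℂ), y * A y * deriv h y + l * A 0 * h y = r y := by
  obtain ⟨g, hg, hge⟩ := exists_eq_add_id_mul
    ((analyticAt_const (v := A 0) : AnalyticAt ℂ (fun _ : ℂ => A 0) 0).div hA hA0)
  obtain ⟨G, hG, hG0, hG'⟩ := exists_analyticAt_primitive
    ((analyticAt_const (v := (l : ℂ)) : AnalyticAt ℂ (fun _ : ℂ => (l : ℂ)) 0).mul hg)
  obtain ⟨k, hk, hk'⟩ := exists_analyticAt_euler_eq (hG.cexp.mul (hr.div hA hA0)) hl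
  refine ⟨fun y => Complex.exp (-G y) * k y, hG.neg.cexp.mul hk, ?_⟩
  filter_upwards [hG', hk', hk.eventually_analyticAt, hA.continuousAt.eventually_ne hA0]
    with y h1 h2 h3 h4
  have h5 := (h1.neg.cexp.mul h3.differentiableAt.hasDerivAt).deriv
  have h6 : A 0 = A y * (1 + y * g y) := by
    have := hge y
    simp only [Pi.div_apply, div_self hA0] at this
    rw [← this]; field_simp
  have h7 : Complex.exp (-G y) * Complex.exp (G y) = 1 := by rw [← Complex.exp_add]; simp
  simp only [Pi.mul_apply, Pi.div_apply, Pi.neg_apply, Function.comp_apply] at h2 h5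
  have h8 : A y * (r y / A y) = r y := by field_simp
  have h9 : deriv (fun y => Complex.exp (-G y) * k y) y
      = Complex.exp (-G y) * -(l * g y) * k y + Complex.exp (-G y) * deriv k y := h5
  rw [h9]
  linear_combination A y * Complex.exp (-G y) * h2 + l * Complex.exp (-G y) * k y * h6
    + A y * (r y / A y) * h7 + h8

/-- In the coordinate `Y = y m(y)` which linearizes `y e(y) ∂_y`, the eigenfunctions of this vector
field are the constant multiples of the powers of `Y`. -/
theorem exists_eq_const_mul_pow {g e m : ℂ → ℂ} (hg : AnalyticAt ℂ g 0) (he : AnalyticAt ℂ e 0)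
    (he0 : e 0 ≠ 0) (hm : AnalyticAt ℂ m 0) (hm0 : m 0 ≠ 0)
    (hem : ∀ᶠ y in 𝓝 (0 : ℂ), e y * (m y + y * deriv m y) = e 0 * m y) (N : ℕ)
    (h : ∀ᶠ y in 𝓝 (0 : ℂ), y * e y * deriv g y = N * e 0 * g y) :
    ∃ E : ℂ, ∀ᶠ y in 𝓝 (0 : ℂ), g y = E * (y * m y) ^ N := by
  rcases eventually_eq_zero_or_order_eq hg he.continuousAt
    (continuousAt_const (y := N * e 0)) h with h0 | ⟨n, k, hk, hk0, hgk, hn⟩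
  · exact ⟨0, by simpa using h0⟩
  obtain rfl : n = N := by exact_mod_cast mul_right_cancel₀ he0 hn
  have hr : AnalyticAt ℂ (fun y => k y / m y ^ n) 0 := hk.div (hm.pow n) (pow_ne_zero _ hm0)
  have hr' : ∀ᶠ y in 𝓝 (0 : ℂ), deriv (fun y => k y / m y ^ n) y = 0 := by
    refine analyticAt_eventuallyEq_of_id_mul hr.deriv analyticAt_const ?_
    filter_upwards [h, hgk.eventually_nhds, hem, hk.eventually_analyticAt, hm.eventually_analyticAt,
      hm.continuousAt.eventually_ne hm0, he.continuousAt.eventually_ne he0] with y h1 h2 h3 h4 h5 h6 h7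
    rcases eq_or_ne y 0 with rfl | hy
    · simp
    have h8 : deriv g y = n * y ^ (n - 1) * k y + y ^ n * deriv k y := by
      rw [EventuallyEq.deriv_eq h2]
      exact ((hasDerivAt_pow n y).mul h4.differentiableAt.hasDerivAt).deriv
    have h9 : deriv (fun y => k y / m y ^ n) y
        = (deriv k y * m y ^ n - k y * (n * m y ^ (n - 1) * deriv m y)) / (m y ^ n) ^ 2 :=
      (h4.differentiableAt.hasDerivAt.div (h5.differentiableAt.hasDerivAt.pow n)
        (pow_ne_zero _ h6)).deriv
    have hp : ∀ z : ℂ, z * (n * z ^ (n - 1) : ℂ) = n * z ^ n := by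
      intro z
      rcases n with _ | n
      · simp
      · simp [pow_succ]; ring
    have h10 : y ^ n ≠ 0 := pow_ne_zero _ hy
    have h11 : e y * n * k y + y * e y * deriv k y = n * e 0 * k y := by
      rw [h8, h2.self_of_nhds] at h1
      apply mul_left_cancel₀ h10
      linear_combination h1 - e y * k y * hp y
    have h12 : y * (deriv k y * m y ^ n - k y * (n * m y ^ (n - 1) * deriv m y)) = 0 := by
      apply mul_left_cancel₀ (mul_ne_zero h7 h6)
      linear_combination m y ^ (n + 1) * h11 - k y * n * m y ^ n * h3
        - e y * y * k y * deriv m y * hp (m y)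
    rw [h9, mul_div_assoc', h12]; simp
  refine ⟨k 0 / m 0 ^ n, ?_⟩
  filter_upwards [eventually_eq_of_deriv_eq_zero hr hr', hgk, hm.continuousAt.eventually_ne hm0]
    with y h1 h2 h3
  rw [h2, ← h1, mul_pow]; field_simp

/-! ### Normalization of an affine symmetry -/

/-- The equations which a symmetry `(x (a + e(y)) - b) ∂_x + y e(y) ∂_y` imposes on the
coefficients `f₀`, `f₁` of the shear-invariant equation, together with the analyticity of the data.
Symmetries of this form preserve the family of fibres `y = const` and act affinely on them. -/
structure AffineSymmetry (f₀ f₁ e : ℂ → ℂ) (a b : ℂ) : Prop where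
  an₀ : AnalyticAt ℂ f₀ 0
  an₁ : AnalyticAt ℂ f₁ 0
  an_e : AnalyticAt ℂ e 0
  eq_e : ∀ᶠ y in 𝓝 (0 : ℂ), deriv (deriv e) y = 2 * b * f₁ y
  eq₁ : ∀ᶠ y in 𝓝 (0 : ℂ),
    3 * b * f₀ y + (a + 3 * e y) * f₁ y + y * e y * deriv f₁ y = 0
  eq₀ : ∀ᶠ y in 𝓝 (0 : ℂ),
    y * e y * deriv f₀ y = (y * deriv e y - 4 * e y - 2 * a) * f₀ y

/-- The data of a point transformation `(X, Y) = (x m(y) + h(y), y m(y))` such that the transformed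
equation, a cubic form in `Y - X Y'` and `Y'`, has no terms of degree at most one in `Y - X Y'`. The
function `k`, with `m² k = y m h' - h (y m)'`, enters through
`Y - X Y' = m² (y - x y' + k y') / D X`, where `D X` is the total derivative of `X`. -/
structure IsNormalizing (f₀ f₁ m h k : ℂ → ℂ) : Prop where
  an_m : AnalyticAt ℂ m 0
  an_h : AnalyticAt ℂ h 0
  m_ne : m 0 ≠ 0
  eq_k : ∀ᶠ y in 𝓝 (0 : ℂ), m y ^ 2 * k y = y * m y * deriv h y - h y * (m y + y * deriv m y)
  eq_linear : ∀ᶠ y in 𝓝 (0 : ℂ),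
    deriv (deriv m) y * (m y + y * deriv m y)
        - deriv m y * (2 * deriv m y + y * deriv (deriv m) y)
      = (m y + y * deriv m y) * m y * k y * (2 * f₁ y - 3 * f₀ y * k y)
  eq_const : ∀ᶠ y in 𝓝 (0 : ℂ),
    deriv h y * (2 * deriv m y + y * deriv (deriv m) y)
        - deriv (deriv h) y * (m y + y * deriv m y)
      = (m y + y * deriv m y) * m y * k y ^ 2 * (f₁ y - 2 * f₀ y * k y)

/-- An affine symmetry can be brought to the linear form by a normalizing transformation, and then
the two coefficients of the transformed equation, `f₀ (y m)' / m⁵` and `(f₁ - 3 f₀ k) / m³`, are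
homogeneous with respect to it. The coordinate `Y = y m(y)` linearizes `y e(y) ∂_y`, and `h` is
chosen such that the field acts on `X = x m(y) + h(y)` as multiplication by `a + e(0)`. -/
theorem AffineSymmetry.exists_normalizing {f₀ f₁ e : ℂ → ℂ} {a b : ℂ}
    (S : AffineSymmetry f₀ f₁ e a b) (he0 : e 0 ≠ 0) {l : ℝ} (hl : 1 ≤ l)
    (ha : a = -(l + 1) * e 0) :
    ∃ m h k : ℂ → ℂ, IsNormalizing f₀ f₁ m h k ∧ AnalyticAt ℂ k 0 ∧
      (a + e 0) * h 0 + b = 0 ∧ (b = 0 → ∀ y, h y = 0) ∧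
      (∀ᶠ y in 𝓝 (0 : ℂ), e y * (m y + y * deriv m y) = e 0 * m y) ∧
      ∃ g₀ g₁ : ℂ → ℂ, AnalyticAt ℂ g₀ 0 ∧ AnalyticAt ℂ g₁ 0 ∧
        (∀ᶠ y in 𝓝 (0 : ℂ), g₀ y * m y ^ 5 = (m y + y * deriv m y) * f₀ y) ∧
        (∀ᶠ y in 𝓝 (0 : ℂ), g₁ y * m y ^ 3 = f₁ y - 3 * f₀ y * k y) ∧
        (∀ᶠ y in 𝓝 (0 : ℂ), y * e y * deriv g₀ y = (-4 * e 0 - 2 * a) * g₀ y) ∧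
        (∀ᶠ y in 𝓝 (0 : ℂ), y * e y * deriv g₁ y = (-3 * e 0 - a) * g₁ y) := by
  have an₀ := S.an₀
  have an₁ := S.an₁
  have an_e := S.an_e
  obtain ⟨m, hm, hm0, hem⟩ := exists_linearizing_factor S.an_e he0
  have hm0' : m 0 ≠ 0 := by simp [hm0]
  -- For `b = 0` the solution `h = 0` is taken, so that the transformation creates no `x`-shift.
  obtain ⟨h, hh, hhb, hh'⟩ : ∃ h : ℂ → ℂ, AnalyticAt ℂ h 0 ∧ (b = 0 → ∀ y, h y = 0) ∧
      ∀ᶠ y in 𝓝 (0 : ℂ), y * e y * deriv h y + l * e 0 * h y = b * m y := by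
    by_cases hb : b = 0
    · exact ⟨0, analyticAt_const, fun _ _ => rfl, by
        simp only [hb, Pi.zero_apply, mul_zero, zero_mul]
        refine Eventually.of_forall fun y => ?_
        have : deriv (0 : ℂ → ℂ) y = 0 := deriv_const y 0
        rw [this]; ring⟩
    · obtain ⟨h, h1, h2⟩ := exists_analyticAt_regular_singular S.an_e he0
        (analyticAt_const.mul hm) hl (r := fun y => b * m y)
      exact ⟨h, h1, fun h0 => absurd h0 hb, h2⟩
  have ev_e := S.an_e.continuousAt.eventually_ne he0
  have ev_m := hm.continuousAt.eventually_ne hm0'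
  obtain ⟨k, hk, hK⟩ : ∃ k : ℂ → ℂ, AnalyticAt ℂ k 0 ∧
      ∀ᶠ y in 𝓝 (0 : ℂ), e y * m y * k y = a * h y + b * m y := by
    refine ⟨fun y => (a * h y + b * m y) / (e y * m y), ?_, ?_⟩
    · have : e 0 * m 0 ≠ 0 := mul_ne_zero he0 hm0'
      fun_prop (disch := assumption)
    · filter_upwards [ev_e, ev_m] with y h1 h2
      field_simp
  have hkey : ∀ᶠ y in 𝓝 (0 : ℂ), m y ^ 2 * k y
      = y * m y * deriv h y - h y * (m y + y * deriv m y) := by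
    filter_upwards [ev_e, hK, hh', hem] with y h1 h2 h3 h4
    apply mul_left_cancel₀ h1
    rw [ha] at h2
    linear_combination m y * h2 - m y * h3 + h y * h4
  -- Derivatives of the defining relations.
  have dm := hm.eventually_analyticAt
  have dh := hh.eventually_analyticAt
  have dk := hk.eventually_analyticAt
  have de := S.an_e.eventually_analyticAt
  have d0 := S.an₀.eventually_analyticAt
  have d1 := S.an₁.eventually_analyticAt
  have hk1 : ∀ᶠ y in 𝓝 (0 : ℂ),
      y * e y * deriv k y = (a + e y - y * deriv e y) * k y - b := by
    filter_upwards [ev_e, ev_m, hK.eventually_nhds, hh', hem, dm, dh, dk, de]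
      with y h1 h2 h3 h4 h5 h6 h7 h8 h9
    have h10 := EventuallyEq.deriv_eq h3
    have e1 : deriv (fun y => e y * m y * k y) y
        = (deriv e y * m y + e y * deriv m y) * k y + e y * m y * deriv k y :=
      ((h9.differentiableAt.hasDerivAt.mul h6.differentiableAt.hasDerivAt).mul
        h8.differentiableAt.hasDerivAt).deriv
    have e2 : deriv (fun y => a * h y + b * m y) y = a * deriv h y + b * deriv m y :=
      ((h7.differentiableAt.hasDerivAt.const_mul a).add
        (h6.differentiableAt.hasDerivAt.const_mul b)).deriv
    rw [e1, e2] at h10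
    have h11 := h3.self_of_nhds
    apply mul_left_cancel₀ (mul_ne_zero h1 h2)
    rw [ha] at h10 h11 ⊢
    linear_combination y * e y * h10 - e y * k y * h5 - (l + 1) * e 0 * h4 + b * h5
      + (l * e 0) * h11
  -- The difference of the two sides has zero derivative by the equations for `f₀` and `f₁`, and it
  -- vanishes at the origin.
  have hG1 : ∀ᶠ y in 𝓝 (0 : ℂ),
      -e 0 + e y - y * deriv e y = e y * y ^ 2 * k y * (2 * f₁ y - 3 * f₀ y * k y) := by
    let G : ℂ → ℂ := fun y => -e 0 + e y - y * deriv e y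
      - e y * y ^ 2 * k y * (2 * f₁ y - 3 * f₀ y * k y)
    have hG : AnalyticAt ℂ G 0 := by
      have := S.an_e.deriv
      fun_prop
    have hG' : ∀ᶠ y in 𝓝 (0 : ℂ), deriv G y = 0 := by
      refine analyticAt_eventuallyEq_of_id_mul hG.deriv analyticAt_const ?_
      filter_upwards [de, d0, d1, dk, hk1, S.eq_e, S.eq₁, S.eq₀] with y he h0 h1 hk r1 r2 r3 r4
      have := (((he.differentiableAt.hasDerivAt.const_add (-e 0)).sub
        ((hasDerivAt_id y).mul he.deriv.differentiableAt.hasDerivAt)).sub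
        (((he.differentiableAt.hasDerivAt.mul (hasDerivAt_pow 2 y)).mul
          hk.differentiableAt.hasDerivAt).mul
          ((h1.differentiableAt.hasDerivAt.const_mul 2).sub
          ((h0.differentiableAt.hasDerivAt.const_mul 3).mul hk.differentiableAt.hasDerivAt)))).deriv
      change deriv G y = _ at this
      rw [this]
      simp only [Nat.cast_ofNat, id_eq, Pi.sub_apply, Pi.mul_apply]
      linear_combination (-y ^ 2) * r2 - y ^ 2 * (2 * f₁ y - 6 * f₀ y * k y) * r1
        - 2 * y ^ 2 * k y * r3 + 3 * y ^ 2 * k y ^ 2 * r4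
    filter_upwards [eventually_eq_of_deriv_eq_zero hG hG'] with y hy
    simp only [G] at hy
    linear_combination hy
  -- The difference `G` of the two sides satisfies `y e G' = (a - 2 y e') G`; a nonzero solution would
  -- vanish to the order `a / e(0) = -(l + 1) < 0`.
  have hG0 : ∀ᶠ y in 𝓝 (0 : ℂ), deriv k y = y * k y ^ 2 * (f₁ y - f₀ y * k y) := by
    let G : ℂ → ℂ := fun y => deriv k y - y * k y ^ 2 * (f₁ y - f₀ y * k y)
    have hG : AnalyticAt ℂ G 0 := by
      have := hk.deriv
      fun_prop
    have hG' : ∀ᶠ y in 𝓝 (0 : ℂ), y * e y * deriv G y = (a - 2 * (y * deriv e y)) * G y := by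
      filter_upwards [de, d0, d1, dk, hk1.eventually_nhds, S.eq_e, S.eq₁, S.eq₀]
        with y he h0 h1 hk r1 r2 r3 r4
      have e0 := EventuallyEq.deriv_eq r1
      have e1 := (((hasDerivAt_id y).mul he.differentiableAt.hasDerivAt).mul
        hk.deriv.differentiableAt.hasDerivAt).deriv
      have e2 := (((((hasDerivAt_const y a).add he.differentiableAt.hasDerivAt).sub
        ((hasDerivAt_id y).mul he.deriv.differentiableAt.hasDerivAt)).mul
        hk.differentiableAt.hasDerivAt).sub_const b).deriv
      replace e0 := e1.symm.trans (e0.trans e2)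
      have := (hk.deriv.differentiableAt.hasDerivAt.sub
        (((hasDerivAt_id y).mul (hk.differentiableAt.hasDerivAt.pow 2)).mul
          (h1.differentiableAt.hasDerivAt.sub
          (h0.differentiableAt.hasDerivAt.mul hk.differentiableAt.hasDerivAt)))).deriv
      change deriv G y = _ at this
      rw [this]
      replace r1 := r1.self_of_nhds
      simp only [Nat.cast_ofNat, id_eq, Pi.sub_apply, Pi.mul_apply, Pi.add_apply, Pi.pow_apply, G]
        at e0 ⊢
      linear_combination e0 - y * (2 * k y * (f₁ y - f₀ y * k y) - k y ^ 2 * f₀ y) * r1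
        - y * k y ^ 2 * r3 + y * k y ^ 3 * r4 - k y * r2 * y
    have hc : ContinuousAt (fun y => a - 2 * (y * deriv e y)) 0 := by
      have := S.an_e.deriv.continuousAt
      fun_prop
    rcases eventually_eq_zero_or_order_eq hG S.an_e.continuousAt hc hG' with h0 | ⟨N, _, _, _, _, hN⟩
    · filter_upwards [h0] with y hy
      exact sub_eq_zero.1 hy
    · exfalso
      rw [ha] at hN
      have h1 : ((N + l + 1 : ℝ) : ℂ) = 0 := by
        apply mul_right_cancel₀ he0
        push_cast
        linear_combination hN
      have h2 : (0 : ℝ) ≤ N := N.cast_nonneg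
      have : (N + l + 1 : ℝ) = 0 := by exact_mod_cast h1
      linarith
  -- This is `y` times the relation `eq_linear`.
  have hlin : ∀ᶠ y in 𝓝 (0 : ℂ), m y * (2 * deriv m y + y * deriv (deriv m) y)
        - 2 * deriv m y * (m y + y * deriv m y)
      = (m y + y * deriv m y) * m y * (y * k y) * (2 * f₁ y - 3 * f₀ y * k y) := by
    have := hm.deriv
    have := hm.deriv.deriv
    refine analyticAt_eventuallyEq_of_mul_left (k := fun y => y * e y) (by fun_prop) (by fun_prop)
      ?_ ?_
    · filter_upwards [self_mem_nhdsWithin, ev_e.filter_mono nhdsWithin_le_nhds] with y h1 h2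
      exact mul_ne_zero h1 h2
    filter_upwards [hem.eventually_nhds, hG1, dm, de] with y h1 h2 h3 h4
    have e0 := EventuallyEq.deriv_eq h1
    have e1 := (h4.differentiableAt.hasDerivAt.mul (h3.differentiableAt.hasDerivAt.add
      ((hasDerivAt_id y).mul h3.deriv.differentiableAt.hasDerivAt))).deriv
    have e2 := (h3.differentiableAt.hasDerivAt.const_mul (e 0)).deriv
    replace e0 := e1.symm.trans (e0.trans e2)
    replace h1 := h1.self_of_nhds
    simp only [id_eq, Pi.mul_apply, Pi.add_apply] at e0
    linear_combination y * m y * e0 + (m y - 2 * (m y + y * deriv m y)) * h1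
      + m y * (m y + y * deriv m y) * h2
  have hkey' : ∀ᶠ y in 𝓝 (0 : ℂ), 2 * m y * deriv m y * k y + m y ^ 2 * deriv k y
      = y * m y * deriv (deriv h) y - h y * (2 * deriv m y + y * deriv (deriv m) y) := by
    filter_upwards [hkey.eventually_nhds, dm, dh, dk] with y h1 h2 h3 h4
    have e0 := EventuallyEq.deriv_eq h1
    have e1 := ((h2.differentiableAt.hasDerivAt.pow 2).mul h4.differentiableAt.hasDerivAt).deriv
    have e2 := ((((hasDerivAt_id y).mul h2.differentiableAt.hasDerivAt).mul
      h3.deriv.differentiableAt.hasDerivAt).sub (h3.differentiableAt.hasDerivAt.mul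
      (h2.differentiableAt.hasDerivAt.add
      ((hasDerivAt_id y).mul h2.deriv.differentiableAt.hasDerivAt)))).deriv
    replace e0 := e1.symm.trans (e0.trans e2)
    simp only [id_eq, Pi.mul_apply, Pi.add_apply, Nat.cast_ofNat, Pi.pow_apply] at e0
    linear_combination e0
  refine ⟨m, h, k, ⟨hm, hh, hm0', hkey, ?_, ?_⟩, hk, ?_, hhb, hem,
    fun y => e 0 * f₀ y / (e y * m y ^ 4), fun y => (f₁ y - 3 * f₀ y * k y) / m y ^ 3, ?_, ?_,
    ?_, ?_, ?_, ?_⟩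
  · have := hm.deriv
    have := hm.deriv.deriv
    refine analyticAt_eventuallyEq_of_id_mul (by fun_prop) (by fun_prop) ?_
    filter_upwards [hlin] with y h1
    linear_combination h1
  · have := hm.deriv
    have := hm.deriv.deriv
    have := hh.deriv
    have := hh.deriv.deriv
    refine analyticAt_eventuallyEq_of_mul_left (k := fun y => y * m y) (by fun_prop) (by fun_prop)
      ?_ ?_
    · filter_upwards [self_mem_nhdsWithin, ev_m.filter_mono nhdsWithin_le_nhds] with y h1 h2
      exact mul_ne_zero h1 h2
    filter_upwards [hlin, hkey, hkey', hG0] with y h1 h2 h3 h4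
    linear_combination (m y * k y) * h1 - (2 * deriv m y + y * deriv (deriv m) y) * h2
      + (m y + y * deriv m y) * h3 - (m y + y * deriv m y) * m y ^ 2 * h4
  · have := hh'.self_of_nhds
    rw [hm0] at this
    rw [ha]
    linear_combination -this
  · have : e 0 * m 0 ^ 4 ≠ 0 := mul_ne_zero he0 (pow_ne_zero _ hm0')
    fun_prop (disch := assumption)
  · have : m 0 ^ 3 ≠ 0 := pow_ne_zero _ hm0'
    fun_prop (disch := assumption)
  · filter_upwards [ev_e, ev_m, hem] with y h1 h2 h3
    field_simp
    linear_combination -f₀ y * h3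
  · filter_upwards [ev_m] with y h2
    field_simp
  · filter_upwards [ev_e, ev_m, hem, dm, de, d0, S.eq₀] with y h1 h2 h3 h4 h5 h6 h7
    have e1 := ((h6.differentiableAt.hasDerivAt.const_mul (e 0)).div
      (h5.differentiableAt.hasDerivAt.mul (h4.differentiableAt.hasDerivAt.pow 4))
      (mul_ne_zero h1 (pow_ne_zero 4 h2))).deriv
    have e2 : ∀ w, deriv (fun y => e 0 * f₀ y / (e y * m y ^ 4)) y = w ↔
      deriv ((fun y => e 0 * f₀ y) / (e * m ^ 4)) y = w := fun w => Iff.rfl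
    rw [(e2 _).2 e1]
    simp only [Pi.mul_apply, Pi.pow_apply]
    field_simp
    linear_combination m y ^ 4 * h7 - 4 * m y ^ 3 * f₀ y * h3
  · filter_upwards [ev_m, hem, dm, dk, d0, d1, S.eq₀, S.eq₁, hk1]
      with y h2 h3 h4 h5 h6 h7 h8 h9 h10
    have e1 := ((h7.differentiableAt.hasDerivAt.sub
      ((h6.differentiableAt.hasDerivAt.const_mul 3).mul h5.differentiableAt.hasDerivAt)).div
      (h4.differentiableAt.hasDerivAt.pow 3) (pow_ne_zero 3 h2)).deriv
    have e2 : ∀ w, deriv (fun y => (f₁ y - 3 * f₀ y * k y) / m y ^ 3) y = w ↔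
      deriv ((f₁ - (fun y => 3 * f₀ y) * k) / m ^ 3) y = w := fun w => Iff.rfl
    rw [(e2 _).2 e1]
    simp only [Pi.mul_apply, Pi.pow_apply, Pi.sub_apply]
    field_simp
    linear_combination m y ^ 3 * h9 - 3 * m y ^ 3 * k y * h8 - 3 * m y ^ 3 * f₀ y * h10
      - 3 * m y ^ 2 * (f₁ y - 3 * f₀ y * k y) * h3

/-! ### The action of a normalizing transformation on the equation -/

/-- The right-hand side `F₀(y) z³ + F₁(y) y' z²`, where `z = y - (x - c) y'`, of a shear-invariant
equation shifted in `x` by `c`. -/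
def shiftedODE (F₀ F₁ : ℂ → ℂ) (c : ℂ) (q : ℂ × ℂ × ℂ) : ℂ :=
  F₀ q.2.1 * (q.2.1 - (q.1 - c) * q.2.2) ^ 3
    + F₁ q.2.1 * q.2.2 * (q.2.1 - (q.1 - c) * q.2.2) ^ 2

theorem hasFDerivAt_quotient {E : Type*} [NormedAddCommGroup E] [NormedSpace ℂ E] {N D : E → ℂ}
    {N' D' : E →L[ℂ] ℂ} {q : E} (hN : HasFDerivAt N N' q) (hD : HasFDerivAt D D' q)
    (h : D q ≠ 0) :
    HasFDerivAt (fun r => N r / D r) ((D q ^ 2)⁻¹ • (D q • N' - N q • D')) q := by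
  have h1 : HasFDerivAt (fun r => (D r)⁻¹) (-(D q ^ 2)⁻¹ • D') q :=
    (hasDerivAt_inv h).comp_hasFDerivAt q hD
  refine (hN.fun_mul h1).congr_fderiv ?_
  ext v
  simp only [smul_apply, add_apply, _root_.sub_apply, smul_eq_mul]
  field_simp
  ring

theorem hasFDerivAt_affineMap {m h : ℂ → ℂ} {ν μ c : ℂ} {z : ℂ × ℂ} (hm : DifferentiableAt ℂ m z.2)
    (hh : DifferentiableAt ℂ h z.2) :
    HasFDerivAt (fun z : ℂ × ℂ => (ν * (z.1 * m z.2 + h z.2) + c, μ * (z.2 * m z.2)))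
      ((ν • (m z.2 • ContinuousLinearMap.fst ℂ ℂ ℂ
          + (z.1 * deriv m z.2 + deriv h z.2) • ContinuousLinearMap.snd ℂ ℂ ℂ)).prod
        (μ • (m z.2 + z.2 * deriv m z.2) • ContinuousLinearMap.snd ℂ ℂ ℂ)) z := by
  have h1 : HasFDerivAt (fun z : ℂ × ℂ => m z.2) _ z :=
    hm.hasFDerivAt.comp z hasFDerivAt_snd
  have h2 : HasFDerivAt (fun z : ℂ × ℂ => h z.2) _ z :=
    hh.hasFDerivAt.comp z hasFDerivAt_snd
  have h3 := ((((hasFDerivAt_fst (𝕜 := ℂ) (p := z)).mul h1).add h2).const_mul ν).add_const c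
  have h4 := ((hasFDerivAt_snd (𝕜 := ℂ) (p := z)).mul h1).const_mul μ
  refine (h3.prodMk h4).congr_fderiv ?_
  ext <;> simp <;> ring

/-- A normalizing transformation, followed by scalings and a shift, takes the shear-invariant
equation to a shifted one. With `z = y - x y'` both sides of the transformation law are cubic forms
in `(z, y')`, whose four coefficients are compared. -/
theorem IsNormalizing.odeEquivalent {f₀ f₁ m h k F₀ F₁ : ℂ → ℂ} {ν μ c : ℂ}
    (T : IsNormalizing f₀ f₁ m h k) (hν : ν ≠ 0) (hμ : μ ≠ 0) (hc : ν * h 0 + c = 0)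
    (h₀ : ∀ᶠ y in 𝓝 (0 : ℂ),
      μ ^ 2 * ν ^ 2 * F₀ (μ * (y * m y)) * m y ^ 5 = (m y + y * deriv m y) * f₀ y)
    (h₁ : ∀ᶠ y in 𝓝 (0 : ℂ),
      ν * μ ^ 2 * F₁ (μ * (y * m y)) * m y ^ 3 = f₁ y - 3 * f₀ y * k y) :
    ODEEquivalent (shearODE f₀ f₁) (shiftedODE F₀ F₁ c) := by
  let Φ : ℂ × ℂ → ℂ × ℂ := fun z => (ν * (z.1 * m z.2 + h z.2) + c, μ * (z.2 * m z.2))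
  have dm := T.an_m.eventually_analyticAt
  have dh := T.an_h.eventually_analyticAt
  have hm2 : AnalyticAt ℂ (fun z : ℂ × ℂ => m z.2) 0 := by
    have : AnalyticAt ℂ m (Prod.snd (0 : ℂ × ℂ)) := T.an_m
    exact this.comp analyticAt_snd
  have hh2 : AnalyticAt ℂ (fun z : ℂ × ℂ => h z.2) 0 := by
    have : AnalyticAt ℂ h (Prod.snd (0 : ℂ × ℂ)) := T.an_h
    exact this.comp analyticAt_snd
  have hΦ0 : HasFDerivAt Φ _ 0 := hasFDerivAt_affineMap (z := 0) (ν := ν) (μ := μ) (c := c)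
    T.an_m.differentiableAt T.an_h.differentiableAt
  have ev1 : ∀ {P : ℂ → Prop}, (∀ᶠ y in 𝓝 (0 : ℂ), P y) → ∀ᶠ q in 𝓝 (0 : ℂ × ℂ × ℂ), P q.2.1 :=
    fun hP => ((continuous_fst.comp continuous_snd).tendsto (0 : ℂ × ℂ × ℂ)).eventually hP
  refine ⟨Φ, ?_, ?_, ?_, ?_, ?_⟩
  · exact ((analyticAt_const.mul ((analyticAt_fst.mul hm2).add hh2)).add analyticAt_const).prod
      (analyticAt_const.mul (analyticAt_snd.mul hm2))
  · simp only [Φ, Prod.fst_zero, Prod.snd_zero, zero_mul, zero_add, mul_zero, hc]; rfl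
  · rw [hΦ0.fderiv]
    have hm0 := T.m_ne
    constructor
    · rw [injective_iff_map_eq_zero]
      rintro ⟨u, v⟩ huv
      have h1 := congrArg Prod.fst huv
      have h2 := congrArg Prod.snd huv
      simp [hμ, hm0] at h1 h2
      subst h2
      simpa [hm0, hν] using h1
    · rintro ⟨u, v⟩
      refine ⟨((u / ν - deriv h 0 * (v / (μ * m 0))) / m 0, v / (μ * m 0)), ?_⟩
      ext <;> simp <;> field_simp
      ring
  · rw [hΦ0.fderiv]; simp
  -- The components of the total derivatives of the transformation.
  have hplane : ∀ᶠ q in 𝓝 (0 : ℂ × ℂ × ℂ), planeDeriv Φ q =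
      (ν * (m q.2.1 + q.2.2 * (q.1 * deriv m q.2.1 + deriv h q.2.1)),
        μ * (q.2.2 * (m q.2.1 + q.2.1 * deriv m q.2.1))) := by
    filter_upwards [ev1 dm, ev1 dh] with q h1 h2
    have h3 : HasFDerivAt Φ _ (basePt q) := hasFDerivAt_affineMap (z := basePt q) (ν := ν) (μ := μ)
      (c := c) h1.differentiableAt h2.differentiableAt
    rw [planeDeriv, h3.fderiv]
    rw [ContinuousLinearMap.prod_apply]
    simp only [smul_apply, add_apply,
      ContinuousLinearMap.coe_fst', ContinuousLinearMap.coe_snd', smul_eq_mul, mul_one]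
    ext
    · simp only [basePt]; ring
    · simp only [basePt]; ring
  have hM : ∀ᶠ q in 𝓝 (0 : ℂ × ℂ × ℂ),
      m q.2.1 + q.2.2 * (q.1 * deriv m q.2.1 + deriv h q.2.1) ≠ 0 := by
    have c1 : ContinuousAt (fun q : ℂ × ℂ × ℂ => q.2.1) 0 := by fun_prop
    have c2 : ContinuousAt (fun q : ℂ × ℂ × ℂ => m q.2.1) 0 :=
      ContinuousAt.comp (f := fun q : ℂ × ℂ × ℂ => q.2.1) (x := 0) T.an_m.continuousAt c1
    have c3 : ContinuousAt (fun q : ℂ × ℂ × ℂ => deriv m q.2.1) 0 :=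
      ContinuousAt.comp (f := fun q : ℂ × ℂ × ℂ => q.2.1) (x := 0) T.an_m.deriv.continuousAt c1
    have c4 : ContinuousAt (fun q : ℂ × ℂ × ℂ => deriv h q.2.1) 0 :=
      ContinuousAt.comp (f := fun q : ℂ × ℂ × ℂ => q.2.1) (x := 0) T.an_h.deriv.continuousAt c1
    refine ContinuousAt.eventually_ne
      (c2.add (continuousAt_snd.snd.mul ((continuousAt_fst.mul c3).add c4))) ?_
    simpa using T.m_ne
  filter_upwards [hplane.eventually_nhds, hM, ev1 dm, ev1 dh, ev1 h₀, ev1 h₁, ev1 T.eq_k,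
    ev1 T.eq_linear, ev1 T.eq_const, ev1 (T.an_m.continuousAt.eventually_ne T.m_ne)]
    with q h1 h2 h3 h4 h5 h6 h7 h8 h9 h10
  obtain ⟨x, y, p⟩ := q
  have h1' := h1.self_of_nhds
  simp only at h2 h3 h4 h5 h6 h7 h8 h9 h10 h1'
  have hlift : (fun r => (liftMap Φ r).2.2) =ᶠ[𝓝 (x, y, p)] fun q =>
      (μ * (q.2.2 * (m q.2.1 + q.2.1 * deriv m q.2.1))) /
      (ν * (m q.2.1 + q.2.2 * (q.1 * deriv m q.2.1 + deriv h q.2.1))) := by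
    filter_upwards [h1] with r hr
    simp only [liftMap, hr]
  let L1 : ℂ × ℂ × ℂ →L[ℂ] ℂ := ContinuousLinearMap.fst ℂ ℂ (ℂ × ℂ)
  let L2 : ℂ × ℂ × ℂ →L[ℂ] ℂ :=
    (ContinuousLinearMap.fst ℂ ℂ ℂ).comp (ContinuousLinearMap.snd ℂ ℂ (ℂ × ℂ))
  let L3 : ℂ × ℂ × ℂ →L[ℂ] ℂ :=
    (ContinuousLinearMap.snd ℂ ℂ ℂ).comp (ContinuousLinearMap.snd ℂ ℂ (ℂ × ℂ))
  have hx : HasFDerivAt (fun q : ℂ × ℂ × ℂ => q.1) L1 (x, y, p) := L1.hasFDerivAt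
  have hy : HasFDerivAt (fun q : ℂ × ℂ × ℂ => q.2.1) L2 (x, y, p) := L2.hasFDerivAt
  have hp : HasFDerivAt (fun q : ℂ × ℂ × ℂ => q.2.2) L3 (x, y, p) := L3.hasFDerivAt
  have hm : HasFDerivAt (fun q : ℂ × ℂ × ℂ => m q.2.1) (deriv m y • L2) (x, y, p) :=
    HasDerivAt.comp_hasFDerivAt (h₂ := m) (x, y, p) h3.differentiableAt.hasDerivAt hy
  have hm' : HasFDerivAt (fun q : ℂ × ℂ × ℂ => deriv m q.2.1) (deriv (deriv m) y • L2) (x, y, p) :=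
    HasDerivAt.comp_hasFDerivAt (h₂ := deriv m) (x, y, p)
      h3.deriv.differentiableAt.hasDerivAt hy
  have hh' : HasFDerivAt (fun q : ℂ × ℂ × ℂ => deriv h q.2.1) (deriv (deriv h) y • L2) (x, y, p) :=
    HasDerivAt.comp_hasFDerivAt (h₂ := deriv h) (x, y, p)
      h4.deriv.differentiableAt.hasDerivAt hy
  have hN := (hp.fun_mul (hm.fun_add (hy.fun_mul hm'))).const_mul μ
  have hD := (hm.fun_add (hp.fun_mul ((hx.fun_mul hm').fun_add hh'))).const_mul ν
  have hNz : ν * (m y + p * (x * deriv m y + deriv h y)) ≠ 0 := mul_ne_zero hν h2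
  have hquot := hasFDerivAt_quotient hN hD hNz
  rw [totalDeriv, EventuallyEq.fderiv_eq hlift, hquot.fderiv]
  have hb : Φ (basePt (x, y, p)) = (ν * (x * m y + h y) + c, μ * (y * m y)) := rfl
  simp only [liftMap, h1', shiftedODE, hb]
  simp only [smul_apply, add_apply, _root_.sub_apply, smul_eq_mul, L1, L2, L3,
    ContinuousLinearMap.coe_fst', ContinuousLinearMap.coe_snd', ContinuousLinearMap.comp_apply]
  have e1 : shearODE f₀ f₁ (x, y, p) = f₀ y * (y - x * p) ^ 3 + f₁ y * p * (y - x * p) ^ 2 := rfl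
  rw [e1]
  set m₀ := m y
  set m₁ := deriv m y
  set m₂ := deriv (deriv m) y
  set k₀ := k y
  set h₀ := h y
  set h₁ := deriv h y
  set h₂ := deriv (deriv h) y
  set φ₀ := f₀ y
  set φ₁ := f₁ y
  set G₀ := F₀ (μ * (y * m₀))
  set G₁ := F₁ (μ * (y * m₀))
  -- Everything is expressed in terms of `f₀`, `f₁`, `m` and `h`.
  have h11 : G₀ = (m₀ + y * m₁) * φ₀ / (μ ^ 2 * ν ^ 2 * m₀ ^ 5) := by
    field_simp; linear_combination h5
  have h12 : G₁ = (φ₁ - 3 * φ₀ * k₀) / (ν * μ ^ 2 * m₀ ^ 3) := by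
    field_simp; linear_combination h6
  have h13 : k₀ = (y * m₀ * h₁ - h₀ * (m₀ + y * m₁)) / m₀ ^ 2 := by
    field_simp; linear_combination h7
  have e2 : μ * (y * m₀) - (ν * (x * m₀ + h₀) + c - c) *
      (μ * (p * (m₀ + y * m₁)) / (ν * (m₀ + p * (x * m₁ + h₁))))
      = μ * m₀ ^ 2 * ((y - x * p) + p * k₀) / (m₀ + p * (x * m₁ + h₁)) := by
    rw [h13]; field_simp; ring
  rw [e2]
  rw [h11, h12]
  field_simp
  linear_combination p ^ 2 * (y - x * p) * h8 + p ^ 3 * h9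

/-! ### Equations with an affine symmetry -/

namespace AffineSymmetry

variable {f₀ f₁ e : ℂ → ℂ} {a b : ℂ}

/-- If `f₁ = 0`, the equation `eq₁` reads `3 b f₀ = 0`. -/
theorem not_eventually_zero (S : AffineSymmetry f₀ f₁ e a b) (hb : b ≠ 0)
    (hf : ¬ ((∀ᶠ y in 𝓝 (0 : ℂ), f₀ y = 0) ∧ ∀ᶠ y in 𝓝 (0 : ℂ), f₁ y = 0)) :
    ¬ ∀ᶠ y in 𝓝 (0 : ℂ), f₁ y = 0 := by
  intro h
  refine hf ⟨?_, h⟩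
  filter_upwards [h.eventually_nhds, S.eq₁] with y h1 h2
  have h3 : deriv f₁ y = 0 := by
    rw [EventuallyEq.deriv_eq (f := fun _ => 0) h1]; simp
  rw [h3, h1.self_of_nhds] at h2
  simpa [hb] using h2

theorem continuousAt_eq₀ (S : AffineSymmetry f₀ f₁ e a b) :
    ContinuousAt (fun y => y * deriv e y - 4 * e y - 2 * a) 0 := by
  have := S.an_e.continuousAt
  have := S.an_e.deriv.continuousAt
  fun_prop

/-- The order of vanishing of `f₀` or of `f₁` determines the eigenvalue `a`. -/
theorem order_cases (S : AffineSymmetry f₀ f₁ e a b)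
    (hf : ¬ ((∀ᶠ y in 𝓝 (0 : ℂ), f₀ y = 0) ∧ ∀ᶠ y in 𝓝 (0 : ℂ), f₁ y = 0)) :
    ∃ N : ℕ, 2 * a = -(N + 4) * e 0 ∨ a = -(N + 3) * e 0 := by
  rcases eventually_eq_zero_or_order_eq S.an₀ S.an_e.continuousAt S.continuousAt_eq₀ S.eq₀ with
    h | ⟨N, _, _, _, _, hN⟩
  · have hc : ContinuousAt (fun y => -(a + 3 * e y)) 0 := by
      have := S.an_e.continuousAt
      fun_prop
    have h1 : ∀ᶠ y in 𝓝 (0 : ℂ), y * e y * deriv f₁ y = -(a + 3 * e y) * f₁ y := by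
      filter_upwards [h, S.eq₁] with y h1 h2
      linear_combination h2 - 3 * b * h1
    rcases eventually_eq_zero_or_order_eq S.an₁ S.an_e.continuousAt hc h1 with
      h' | ⟨N, _, _, _, _, hN⟩
    · exact absurd ⟨h, h'⟩ hf
    · exact ⟨N, Or.inr (by linear_combination hN)⟩
  · exact ⟨N, Or.inl (by linear_combination hN)⟩

/-- The vector field `y e(y) ∂_y` cannot vanish to second order at the origin. Otherwise `a = 0`,
and the equations force `y g' + 4 g = 0` for `g = 3 f₁ + y f₁'`, so that `g`, and then `f₁`,
vanishes. -/
theorem e_ne_zero (S : AffineSymmetry f₀ f₁ e a b) (hb : b ≠ 0)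
    (hf : ¬ ((∀ᶠ y in 𝓝 (0 : ℂ), f₀ y = 0) ∧ ∀ᶠ y in 𝓝 (0 : ℂ), f₁ y = 0)) : e 0 ≠ 0 := by
  intro he0
  have hf₁ := S.not_eventually_zero hb hf
  have ha : a = 0 := by
    obtain ⟨N, h | h⟩ := S.order_cases hf <;> simpa [he0] using h
  have he : ¬ ∀ᶠ y in 𝓝 (0 : ℂ), e y = 0 := by
    intro h
    apply hf₁
    filter_upwards [h.eventually_nhds.eventually_nhds, S.eq_e] with y h1 h2
    have h3 : deriv e =ᶠ[𝓝 y] fun _ => 0 := by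
      filter_upwards [h1] with z hz
      rw [EventuallyEq.deriv_eq (f := fun _ => 0) hz]; simp
    rw [h3.deriv_eq] at h2
    simpa [hb] using h2.symm
  have an₁ := S.an₁
  have an₁' := S.an₁.deriv
  have an_e := S.an_e
  let g : ℂ → ℂ := fun y => 3 * f₁ y + y * deriv f₁ y
  have hg : AnalyticAt ℂ g 0 := by fun_prop
  have hg' := hg.deriv
  have h0g : ∀ᶠ y in 𝓝 (0 : ℂ), 3 * b * f₀ y = - (e y * g y) := by
    filter_upwards [S.eq₁] with y hy
    simp only [g]
    rw [ha] at hy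
    linear_combination hy
  have h1 : ∀ᶠ y in 𝓝 (0 : ℂ), e y * (e y * (y * deriv g y + 4 * g y)) = 0 := by
    filter_upwards [h0g.eventually_nhds, S.eq₀, S.an₀.eventually_analyticAt,
      hg.eventually_analyticAt, S.an_e.eventually_analyticAt] with y h1 h2 h3 h4 h5
    have e0 := EventuallyEq.deriv_eq h1
    have e1 := (h3.differentiableAt.hasDerivAt.const_mul (3 * b)).deriv
    have e2 := (h5.differentiableAt.hasDerivAt.mul h4.differentiableAt.hasDerivAt).neg.deriv
    replace e0 := e1.symm.trans (e0.trans e2)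
    replace h1 := h1.self_of_nhds
    rw [ha] at h2
    linear_combination y * e y * e0 - 3 * b * h2 - (y * deriv e y - 4 * e y) * h1
  have h2 := (analyticAt_eventuallyEq_zero_or an_e (by fun_prop) h1).resolve_left he
  have h3 := (analyticAt_eventuallyEq_zero_or an_e (by fun_prop) h2).resolve_left he
  have h4 := eventually_eq_zero_of_euler_eq_zero (n := 4) (by norm_num) hg (by exact_mod_cast h3)
  refine hf₁ (eventually_eq_zero_of_euler_eq_zero (n := 3) (by norm_num) an₁ ?_)
  filter_upwards [h4] with y hy
  simp only [g] at hy
  push_cast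
  linear_combination hy

/-- There is no resonance: with this `l`, the operator `h ↦ y e h' + l e(0) h` is onto on germs if
`e(0) ≠ 0`. -/
theorem exists_eigenvalue (S : AffineSymmetry f₀ f₁ e a b)
    (hf : ¬ ((∀ᶠ y in 𝓝 (0 : ℂ), f₀ y = 0) ∧ ∀ᶠ y in 𝓝 (0 : ℂ), f₁ y = 0)) :
    ∃ l : ℝ, 1 ≤ l ∧ a = -(l + 1) * e 0 := by
  obtain ⟨N, h | h⟩ := S.order_cases hf
  · refine ⟨(N + 2) / 2, by have : (0 : ℝ) ≤ N := N.cast_nonneg; linarith, ?_⟩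
    push_cast
    linear_combination h / 2
  · refine ⟨N + 2, by have : (0 : ℝ) ≤ N := N.cast_nonneg; linarith, ?_⟩
    push_cast
    linear_combination h

end AffineSymmetry

theorem exists_pow_eq_of_ne_zero {n : ℕ} (hn : 0 < n) {z : ℂ} (hz : z ≠ 0) :
    ∃ w : ℂ, w ≠ 0 ∧ w ^ n = z := by
  obtain ⟨w, hw⟩ := IsAlgClosed.exists_pow_nat_eq z hn
  exact ⟨w, fun h => hz (by rw [← hw, h, zero_pow hn.ne']), hw⟩

theorem shiftedODE_firstSeries (j : ℕ) (c : ℂ) :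
    shiftedODE (fun y => y ^ j) 0 c = xShift c (firstSeries j) := by
  funext q
  simp [shiftedODE, xShift, firstSeries]

theorem shiftedODE_secondSeries (j : ℕ) (C c : ℂ) :
    shiftedODE (fun y => C * y ^ (2 * j + 2)) (fun y => y ^ j) c = xShift c (secondSeries j C) := by
  funext q
  simp only [shiftedODE, xShift, secondSeries]
  ring

namespace AffineSymmetry

variable {f₀ f₁ e : ℂ → ℂ} {a b : ℂ}

/-- After normalization the coefficients are monomials `E₀ Y ^ N₀` and `E₁ Y ^ N₁`; the scalings
`x ↦ ν x`, `y ↦ μ y` bring the `x`-shift and the leading coefficient to the prescribed values. In the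
case `b = 0` no `x`-shift is created. -/
theorem odeEquivalent (S : AffineSymmetry f₀ f₁ e a b) (he0 : e 0 ≠ 0) {l : ℝ} (hl : 1 ≤ l)
    (ha : a = -(l + 1) * e 0)
    (hf : ¬ ((∀ᶠ y in 𝓝 (0 : ℂ), f₀ y = 0) ∧ ∀ᶠ y in 𝓝 (0 : ℂ), f₁ y = 0)) :
    (∃ j : ℕ, (j : ℝ) = 2 * l - 2 ∧
      ∀ c : ℂ, (b = 0 ↔ c = 0) → ODEEquivalent (shearODE f₀ f₁) (xShift c (firstSeries j))) ∨
    (∃ (j : ℕ) (C : ℂ), (j : ℝ) = l - 2 ∧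
      ∀ c : ℂ, (b = 0 ↔ c = 0) → ODEEquivalent (shearODE f₀ f₁) (xShift c (secondSeries j C))) := by
  obtain ⟨m, h, k, T, hk, hb, hb0, hem, g₀, g₁, hg₀, hg₁, h₀, h₁, hg₀', hg₁'⟩ :=
    S.exists_normalizing he0 hl ha
  have hl0 : (l : ℂ) ≠ 0 := by
    exact_mod_cast (by linarith : l ≠ 0)
  have hν : ∀ c : ℂ, (b = 0 ↔ c = 0) → ∃ ν : ℂ, ν ≠ 0 ∧ ν * h 0 + c = 0 := by
    intro c hc
    by_cases hb' : b = 0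
    · exact ⟨1, one_ne_zero, by simp [hb0 hb' 0, hc.1 hb']⟩
    · have hc' : c ≠ 0 := fun h => hb' (hc.2 h)
      have hh : h 0 ≠ 0 := by
        intro h0
        rw [h0] at hb
        exact hb' (by linear_combination hb)
      exact ⟨-c / h 0, div_ne_zero (neg_ne_zero.2 hc') hh, by field_simp; ring⟩
  have hY : ∀ᶠ y in 𝓝 (0 : ℂ), m y + y * deriv m y ≠ 0 := by
    have := T.an_m.continuousAt
    have := T.an_m.deriv.continuousAt
    refine ContinuousAt.eventually_ne (by fun_prop) ?_
    simpa using T.m_ne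
  rcases eventually_eq_zero_or_order_eq hg₁ S.an_e.continuousAt continuousAt_const hg₁' with
    hz | ⟨j, _, _, hk0, hgk, hj⟩
  · left
    rcases eventually_eq_zero_or_order_eq hg₀ S.an_e.continuousAt continuousAt_const hg₀' with
      hz' | ⟨j, u, hu, hu0, hgu, hj⟩
    · exfalso
      have hf0 : ∀ᶠ y in 𝓝 (0 : ℂ), f₀ y = 0 := by
        filter_upwards [h₀, hz', hY] with y h1 h2 h3
        rw [h2, zero_mul] at h1
        exact (mul_eq_zero.1 h1.symm).resolve_left h3
      refine hf ⟨hf0, ?_⟩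
      filter_upwards [h₁, hz, hf0] with y h1 h2 h3
      rw [h2, h3] at h1
      linear_combination -h1
    have hjl : (j : ℂ) = 2 * l - 2 := by
      apply mul_right_cancel₀ he0
      rw [hj, ha]; ring
    refine ⟨j, by exact_mod_cast hjl, fun c hc => ?_⟩
    obtain ⟨ν, hν0, hνc⟩ := hν c hc
    obtain ⟨E, hE⟩ := exists_eq_const_mul_pow hg₀ S.an_e he0 T.an_m T.m_ne hem j (by
      filter_upwards [hg₀'] with y hy
      rw [hy, hj])
    have hE0 : E ≠ 0 := by
      rintro rfl
      refine hu0 (analyticAt_eventuallyEq_of_mul_left (f := u) hu (analyticAt_const (v := 0))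
        (k := fun y => y ^ j) (eventually_mem_nhdsWithin.mono fun y hy => pow_ne_zero j hy)
        ?_).self_of_nhds
      filter_upwards [hE, hgu] with y h1 h2
      rw [← h2, h1]; ring
    obtain ⟨μ, hμ0, hμ⟩ := exists_pow_eq_of_ne_zero (n := j + 2) (by omega)
      (div_ne_zero hE0 (pow_ne_zero 2 hν0))
    rw [← shiftedODE_firstSeries]
    have hμ' : μ ^ (j + 2) * ν ^ 2 = E := by rw [hμ]; field_simp
    refine T.odeEquivalent hν0 hμ0 hνc ?_ ?_
    · filter_upwards [h₀, hE] with y h1 h2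
      rw [← h1, h2, mul_pow, ← hμ']; ring
    · filter_upwards [h₁, hz] with y h1 h2
      rw [← h1, h2]; simp
  · right
    have hjl : (j : ℂ) = l - 2 := by
      apply mul_right_cancel₀ he0
      rw [hj, ha]; ring
    obtain ⟨E, hE⟩ := exists_eq_const_mul_pow hg₁ S.an_e he0 T.an_m T.m_ne hem j (by
      filter_upwards [hg₁'] with y hy
      rw [hy, hj])
    obtain ⟨E', hE'⟩ := exists_eq_const_mul_pow hg₀ S.an_e he0 T.an_m T.m_ne hem (2 * j + 2) (by
      filter_upwards [hg₀'] with y hy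
      rw [hy, ha]; push_cast; rw [hjl]; ring)
    rename_i u hu
    have hE0 : E ≠ 0 := by
      rintro rfl
      refine hk0 (analyticAt_eventuallyEq_of_mul_left (f := u) hu (analyticAt_const (v := 0))
        (k := fun y => y ^ j) (eventually_mem_nhdsWithin.mono fun y hy => pow_ne_zero j hy)
        ?_).self_of_nhds
      filter_upwards [hE, hgk] with y h1 h2
      rw [← h2, h1]; ring
    refine ⟨j, E' / E ^ 2, by exact_mod_cast hjl, fun c hc => ?_⟩
    obtain ⟨ν, hν0, hνc⟩ := hν c hc
    obtain ⟨μ, hμ0, hμ⟩ := exists_pow_eq_of_ne_zero (n := j + 2) (by omega) (div_ne_zero hE0 hν0)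
    rw [← shiftedODE_secondSeries]
    have hμ' : μ ^ (j + 2) * ν = E := by rw [hμ]; field_simp
    refine T.odeEquivalent hν0 hμ0 hνc ?_ ?_
    · filter_upwards [h₀, hE'] with y h1 h2
      have h3 : (μ ^ (j + 2) * ν) ^ 2 * (E' / E ^ 2) = E' := by rw [hμ']; field_simp
      rw [← h1, h2, mul_pow, mul_pow]
      rw [mul_pow] at h3
      linear_combination (y ^ (2 * j + 2) * m y ^ (2 * j + 2) * m y ^ 5) * h3
    · filter_upwards [h₁, hE] with y h1 h2
      rw [← h1, h2, mul_pow, ← hμ']; ring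

theorem odeEquivalent_series (S : AffineSymmetry f₀ f₁ e a b) (hb : b ≠ 0)
    (hf : ¬ ((∀ᶠ y in 𝓝 (0 : ℂ), f₀ y = 0) ∧ ∀ᶠ y in 𝓝 (0 : ℂ), f₁ y = 0)) :
    (∃ j : ℕ, ∀ c : ℂ, c ≠ 0 → ODEEquivalent (shearODE f₀ f₁) (xShift c (firstSeries j))) ∨
    (∃ (j : ℕ) (C : ℂ), ∀ c : ℂ, c ≠ 0 →
      ODEEquivalent (shearODE f₀ f₁) (xShift c (secondSeries j C))) := by
  obtain ⟨l, hl, ha⟩ := S.exists_eigenvalue hf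
  rcases S.odeEquivalent (S.e_ne_zero hb hf) hl ha hf with ⟨j, _, h⟩ | ⟨j, C, _, h⟩
  · exact Or.inl ⟨j, fun c hc => h c (by simp [hb, hc])⟩
  · exact Or.inr ⟨j, C, fun c hc => h c (by simp [hb, hc])⟩

/-- For `b = 0` and `a = -2 e(0)` the eigenvalue is `l = 1`, which forces the exponent `0` and
excludes the second series, whose exponent would be `-1`. -/
theorem odeEquivalent_sl2 (S : AffineSymmetry f₀ f₁ e a 0) (he0 : e 0 ≠ 0) (ha : a = -2 * e 0)
    (hf : ¬ ((∀ᶠ y in 𝓝 (0 : ℂ), f₀ y = 0) ∧ ∀ᶠ y in 𝓝 (0 : ℂ), f₁ y = 0)) :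
    ODEEquivalent (shearODE f₀ f₁) (xShift 0 (firstSeries 0)) := by
  rcases S.odeEquivalent he0 (le_refl 1) (by rw [ha]; push_cast; ring) hf with
    ⟨j, hj, h⟩ | ⟨j, C, hj, _⟩
  · obtain rfl : j = 0 := by
      have : (j : ℝ) = 0 := by rw [hj]; norm_num
      exact_mod_cast this
    exact h 0 (by simp)
  · have : (0 : ℝ) ≤ j := j.cast_nonneg
    linarith

end AffineSymmetry

/-! ### The determining equations of a symmetry -/

/-- The partial derivative `∂f/∂x` of a function on the plane. -/
noncomputable def pdX (f : ℂ × ℂ → ℂ) (z : ℂ × ℂ) : ℂ := fderiv ℂ f z (1, 0)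

/-- The partial derivative `∂f/∂y` of a function on the plane. -/
noncomputable def pdY (f : ℂ × ℂ → ℂ) (z : ℂ × ℂ) : ℂ := fderiv ℂ f z (0, 1)

theorem fderiv_apply_eq_pd (f : ℂ × ℂ → ℂ) (z v : ℂ × ℂ) :
    fderiv ℂ f z v = v.1 * pdX f z + v.2 * pdY f z := by
  have : v = v.1 • ((1 : ℂ), (0 : ℂ)) + v.2 • ((0 : ℂ), (1 : ℂ)) := by ext <;> simp
  conv_lhs => rw [this]
  rw [map_add, map_smul, map_smul]
  rfl

theorem AnalyticAt.pdX {f : ℂ × ℂ → ℂ} {z : ℂ × ℂ} (hf : AnalyticAt ℂ f z) :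
    AnalyticAt ℂ (pdX f) z :=
  ((ContinuousLinearMap.apply ℂ ℂ ((1 : ℂ), (0 : ℂ))).analyticAt _).comp hf.fderiv

theorem AnalyticAt.pdY {f : ℂ × ℂ → ℂ} {z : ℂ × ℂ} (hf : AnalyticAt ℂ f z) :
    AnalyticAt ℂ (pdY f) z :=
  ((ContinuousLinearMap.apply ℂ ℂ ((0 : ℂ), (1 : ℂ))).analyticAt _).comp hf.fderiv

theorem pdX_pdY_comm {f : ℂ × ℂ → ℂ} {z : ℂ × ℂ} (hf : AnalyticAt ℂ f z) :
    pdY (pdX f) z = pdX (pdY f) z := by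
  have h1 : ∀ v w : ℂ × ℂ,
      fderiv ℂ (fun u => fderiv ℂ f u v) z w = fderiv ℂ (fderiv ℂ f) z w v := by
    intro v w
    have := (hf.fderiv.differentiableAt.hasFDerivAt.clm_apply (hasFDerivAt_const v z)).fderiv
    rw [this]; simp
  exact (h1 _ _).trans ((((hf.contDiffAt (n := ⊤)).isSymmSndFDerivAt (by simp)).eq _ _).trans
    (h1 _ _).symm)

theorem pdX_congr {f g : ℂ × ℂ → ℂ} {z : ℂ × ℂ} (h : f =ᶠ[𝓝 z] g) : pdX f z = pdX g z := by
  rw [pdX, pdX, h.fderiv_eq]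

theorem pdY_congr {f g : ℂ × ℂ → ℂ} {z : ℂ × ℂ} (h : f =ᶠ[𝓝 z] g) : pdY f z = pdY g z := by
  rw [pdY, pdY, h.fderiv_eq]

theorem eq_zero_of_eventually_cubic {c₀ c₁ c₂ c₃ : ℂ}
    (h : ∀ᶠ p in 𝓝 (0 : ℂ), c₀ + c₁ * p + c₂ * p ^ 2 + c₃ * p ^ 3 = 0) :
    c₀ = 0 ∧ c₁ = 0 ∧ c₂ = 0 ∧ c₃ = 0 := by
  have h0 : c₀ = 0 := by simpa using h.self_of_nhds
  have h1 : ∀ᶠ p in 𝓝 (0 : ℂ), c₁ + c₂ * p + c₃ * p ^ 2 = 0 := by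
    refine analyticAt_eventuallyEq_of_id_mul (by fun_prop) analyticAt_const ?_
    filter_upwards [h] with p hp
    linear_combination hp - h0
  have h1' : c₁ = 0 := by simpa using h1.self_of_nhds
  have h2 : ∀ᶠ p in 𝓝 (0 : ℂ), c₂ + c₃ * p = 0 := by
    refine analyticAt_eventuallyEq_of_id_mul (by fun_prop) analyticAt_const ?_
    filter_upwards [h1] with p hp
    linear_combination hp - h1'
  have h2' : c₂ = 0 := by simpa using h2.self_of_nhds
  have h3 : ∀ᶠ p in 𝓝 (0 : ℂ), c₃ = (0 : ℂ) := by
    refine analyticAt_eventuallyEq_of_id_mul (f := fun _ => c₃) analyticAt_const analyticAt_const ?_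
    filter_upwards [h2] with p hp
    linear_combination hp - h2'
  exact ⟨h0, h1', h2', h3.self_of_nhds⟩

/-- The determining equations: the coefficients of `1, p, p², p³` in the condition that
`ξ ∂_x + η ∂_y` is an infinitesimal symmetry of the shear-invariant equation. -/
structure DeterminingEqs (f₀ f₁ : ℂ → ℂ) (ξ η : ℂ × ℂ → ℂ) (x y : ℂ) : Prop where
  eq₀ : pdX (pdX η) (x, y) + (pdY η (x, y) - 2 * pdX ξ (x, y)) * (f₀ y * y ^ 3)
    - η (x, y) * (3 * y ^ 2 * f₀ y + y ^ 3 * deriv f₀ y)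
    - pdX η (x, y) * (y ^ 2 * (f₁ y - 3 * f₀ y * x)) = 0
  eq₁ : 2 * pdX (pdY η) (x, y) - pdX (pdX ξ) (x, y)
    - pdX ξ (x, y) * (y ^ 2 * (f₁ y - 3 * f₀ y * x)) - 3 * pdY ξ (x, y) * (f₀ y * y ^ 3)
    + 3 * f₀ y * y ^ 2 * ξ (x, y)
    - η (x, y) * (2 * y * (f₁ y - 3 * f₀ y * x) + y ^ 2 * (deriv f₁ y - 3 * deriv f₀ y * x))
    - 2 * pdX η (x, y) * (x * y * (3 * f₀ y * x - 2 * f₁ y)) = 0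
  eq₂ : pdY (pdY η) (x, y) - 2 * pdX (pdY ξ) (x, y)
    - pdY η (x, y) * (x * y * (3 * f₀ y * x - 2 * f₁ y))
    - 2 * pdY ξ (x, y) * (y ^ 2 * (f₁ y - 3 * f₀ y * x))
    - ξ (x, y) * (6 * f₀ y * x * y - 2 * f₁ y * y)
    - η (x, y) * (3 * deriv f₀ y * x ^ 2 * y + 3 * f₀ y * x ^ 2 - 2 * deriv f₁ y * x * y
      - 2 * f₁ y * x)
    - 3 * pdX η (x, y) * (x ^ 2 * (f₁ y - f₀ y * x)) = 0
  eq₃ : -pdY (pdY ξ) (x, y) - 2 * pdY η (x, y) * (x ^ 2 * (f₁ y - f₀ y * x))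
    + pdX ξ (x, y) * (x ^ 2 * (f₁ y - f₀ y * x))
    - pdY ξ (x, y) * (x * y * (3 * f₀ y * x - 2 * f₁ y))
    - ξ (x, y) * (2 * x * f₁ y - 3 * x ^ 2 * f₀ y)
    - η (x, y) * (x ^ 2 * (deriv f₁ y - deriv f₀ y * x)) = 0

theorem fderiv_shearODE {f₀ f₁ : ℂ → ℂ} {x y p : ℂ} (h₀ : DifferentiableAt ℂ f₀ y)
    (h₁ : DifferentiableAt ℂ f₁ y) (v : ℂ × ℂ × ℂ) :
    fderiv ℂ (shearODE f₀ f₁) (x, y, p) v =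
      deriv f₀ y * v.2.1 * (y - x * p) ^ 3
      + 3 * f₀ y * (y - x * p) ^ 2 * (v.2.1 - v.1 * p - x * v.2.2)
      + deriv f₁ y * v.2.1 * p * (y - x * p) ^ 2 + f₁ y * v.2.2 * (y - x * p) ^ 2
      + 2 * f₁ y * p * (y - x * p) * (v.2.1 - v.1 * p - x * v.2.2) := by
  let L1 : ℂ × ℂ × ℂ →L[ℂ] ℂ := ContinuousLinearMap.fst ℂ ℂ (ℂ × ℂ)
  let L2 : ℂ × ℂ × ℂ →L[ℂ] ℂ :=
    (ContinuousLinearMap.fst ℂ ℂ ℂ).comp (ContinuousLinearMap.snd ℂ ℂ (ℂ × ℂ))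
  let L3 : ℂ × ℂ × ℂ →L[ℂ] ℂ :=
    (ContinuousLinearMap.snd ℂ ℂ ℂ).comp (ContinuousLinearMap.snd ℂ ℂ (ℂ × ℂ))
  have hx : HasFDerivAt (fun q : ℂ × ℂ × ℂ => q.1) L1 (x, y, p) := L1.hasFDerivAt
  have hy : HasFDerivAt (fun q : ℂ × ℂ × ℂ => q.2.1) L2 (x, y, p) := L2.hasFDerivAt
  have hp : HasFDerivAt (fun q : ℂ × ℂ × ℂ => q.2.2) L3 (x, y, p) := L3.hasFDerivAt
  have g₀ : HasFDerivAt (fun q : ℂ × ℂ × ℂ => f₀ q.2.1) (deriv f₀ y • L2) (x, y, p) :=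
    HasDerivAt.comp_hasFDerivAt (h₂ := f₀) (x, y, p) h₀.hasDerivAt hy
  have g₁ : HasFDerivAt (fun q : ℂ × ℂ × ℂ => f₁ q.2.1) (deriv f₁ y • L2) (x, y, p) :=
    HasDerivAt.comp_hasFDerivAt (h₂ := f₁) (x, y, p) h₁.hasDerivAt hy
  have hz := hy.fun_sub (hx.fun_mul hp)
  have hz3 := HasDerivAt.comp_hasFDerivAt (h₂ := fun w : ℂ => w ^ 3) (x, y, p)
    (hasDerivAt_pow 3 _) hz
  have hz2 := HasDerivAt.comp_hasFDerivAt (h₂ := fun w : ℂ => w ^ 2) (x, y, p)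
    (hasDerivAt_pow 2 _) hz
  have hB : HasFDerivAt (shearODE f₀ f₁) _ (x, y, p) :=
    (g₀.fun_mul hz3).fun_add ((g₁.fun_mul hp).fun_mul hz2)
  rw [hB.fderiv]
  simp only [smul_apply, add_apply, _root_.sub_apply, smul_eq_mul, L1, L2, L3,
    ContinuousLinearMap.coe_fst', ContinuousLinearMap.coe_snd', ContinuousLinearMap.comp_apply]
  norm_num
  ring

/-- On the equation, the symmetry condition is a cubic polynomial in the slope `p`. -/
theorem eventually_determiningEqs {f₀ f₁ : ℂ → ℂ} (hf₀ : AnalyticAt ℂ f₀ 0)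
    (hf₁ : AnalyticAt ℂ f₁ 0) {V : ℂ × ℂ → ℂ × ℂ}
    (hV : IsInfinitesimalSymmetry (shearODE f₀ f₁) V) :
    ∀ᶠ z in 𝓝 (0 : ℂ × ℂ),
      DeterminingEqs f₀ f₁ (fun z => (V z).1) (fun z => (V z).2) z.1 z.2 := by
  obtain ⟨hVa, hV⟩ := hV
  set ξ : ℂ × ℂ → ℂ := fun z => (V z).1
  set η : ℂ × ℂ → ℂ := fun z => (V z).2
  have hbase : Tendsto basePt (𝓝 0) (𝓝 0) :=
    (continuous_fst.prodMk (continuous_fst.comp continuous_snd)).tendsto _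
  have hplane : ∀ {q}, AnalyticAt ℂ V (basePt q) → planeDeriv V q =
      (pdX ξ (basePt q) + q.2.2 * pdY ξ (basePt q), pdX η (basePt q) + q.2.2 * pdY η (basePt q)) := by
    intro q hq
    have e1 := hq.differentiableAt.hasFDerivAt.fst.fderiv
    have e2 := hq.differentiableAt.hasFDerivAt.snd.fderiv
    ext
    · have := fderiv_apply_eq_pd ξ (basePt q) (1, q.2.2)
      simp only [ξ, e1] at this
      simpa [planeDeriv] using this
    · have := fderiv_apply_eq_pd η (basePt q) (1, q.2.2)
      simp only [η, e2] at this
      simpa [planeDeriv] using this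
  have hprolong : ∀ᶠ q in 𝓝 (0 : ℂ × ℂ × ℂ), (prolong V q).2.2 =
      pdX η (basePt q) + q.2.2 * (pdY η (basePt q) - pdX ξ (basePt q))
        - q.2.2 ^ 2 * pdY ξ (basePt q) := by
    filter_upwards [hbase.eventually hVa.eventually_analyticAt] with q hq
    simp only [prolong, hplane hq]
    ring
  have key : ∀ᶠ q in 𝓝 (0 : ℂ × ℂ × ℂ), ∀ x y p, q = (x, y, p) →
      (pdX (pdX η) (x, y) + p * pdX (pdY η) (x, y))
        + p * (pdX (pdY η) (x, y) + p * pdY (pdY η) (x, y)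
          - (pdX (pdX ξ) (x, y) + p * pdX (pdY ξ) (x, y)))
        + shearODE f₀ f₁ (x, y, p) * (pdY η (x, y) - pdX ξ (x, y))
        - p ^ 2 * (pdX (pdY ξ) (x, y) + p * pdY (pdY ξ) (x, y))
        - 2 * p * shearODE f₀ f₁ (x, y, p) * pdY ξ (x, y)
        - shearODE f₀ f₁ (x, y, p) * (pdX ξ (x, y) + p * pdY ξ (x, y))
      = fderiv ℂ (shearODE f₀ f₁) (x, y, p) (ξ (x, y), η (x, y),
          pdX η (x, y) + p * (pdY η (x, y) - pdX ξ (x, y)) - p ^ 2 * pdY ξ (x, y)) := by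
    filter_upwards [hV, hprolong.eventually_nhds,
      hbase.eventually hVa.eventually_analyticAt] with q h1 h2 h3
    rintro x y p rfl
    have h2' := h2.self_of_nhds
    have h4 : prolong V (x, y, p) = (ξ (x, y), η (x, y),
          pdX η (x, y) + p * (pdY η (x, y) - pdX ξ (x, y)) - p ^ 2 * pdY ξ (x, y)) := by
      ext
      · rfl
      · rfl
      · exact h2'
    rw [h4, hplane h3, totalDeriv, EventuallyEq.fderiv_eq h2] at h1
    have h3 : AnalyticAt ℂ V (x, y) := h3
    have hξ : AnalyticAt ℂ ξ (x, y) := analyticAt_fst.comp h3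
    have hη : AnalyticAt ℂ η (x, y) := analyticAt_snd.comp h3
    let L : ℂ × ℂ × ℂ →L[ℂ] ℂ × ℂ := (ContinuousLinearMap.fst ℂ ℂ (ℂ × ℂ)).prod
      ((ContinuousLinearMap.fst ℂ ℂ ℂ).comp (ContinuousLinearMap.snd ℂ ℂ (ℂ × ℂ)))
    let L3 : ℂ × ℂ × ℂ →L[ℂ] ℂ :=
      (ContinuousLinearMap.snd ℂ ℂ ℂ).comp (ContinuousLinearMap.snd ℂ ℂ (ℂ × ℂ))
    have hL : HasFDerivAt basePt L (x, y, p) := L.hasFDerivAt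
    have hp : HasFDerivAt (fun q : ℂ × ℂ × ℂ => q.2.2) L3 (x, y, p) := L3.hasFDerivAt
    have comp : ∀ {f : ℂ × ℂ → ℂ}, AnalyticAt ℂ f (x, y) →
        HasFDerivAt (fun q => f (basePt q)) ((fderiv ℂ f (x, y)).comp L) (x, y, p) := by
      intro f hf
      exact HasFDerivAt.comp (g := f) (x, y, p) hf.differentiableAt.hasFDerivAt hL
    have hp2 : HasFDerivAt (fun q : ℂ × ℂ × ℂ => q.2.2 ^ 2) _ (x, y, p) :=
      HasDerivAt.comp_hasFDerivAt (h₂ := fun w : ℂ => w ^ 2) (x, y, p) (hasDerivAt_pow 2 _) hp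
    have hD := ((comp hη.pdX).fun_add (hp.fun_mul ((comp hη.pdY).fun_sub (comp hξ.pdX)))).fun_sub
      (hp2.fun_mul (comp hξ.pdY))
    rw [hD.fderiv] at h1
    rw [← h1]
    simp only [smul_apply, add_apply, _root_.sub_apply, smul_eq_mul,
      ContinuousLinearMap.comp_apply, fderiv_apply_eq_pd, pdX_pdY_comm hξ, pdX_pdY_comm hη,
      L, L3, ContinuousLinearMap.prod_apply, ContinuousLinearMap.coe_fst',
      ContinuousLinearMap.coe_snd', basePt]
    norm_num
    ring
  have hassoc : Tendsto (fun w : (ℂ × ℂ) × ℂ => (w.1.1, w.1.2, w.2)) (𝓝 0 ×ˢ 𝓝 0) (𝓝 0) := by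
    rw [← nhds_prod_eq]
    exact (Continuous.tendsto (by fun_prop) _)
  filter_upwards [(hassoc.eventually key).curry,
    (continuous_snd.tendsto (0 : ℂ × ℂ)).eventually hf₀.eventually_analyticAt,
    (continuous_snd.tendsto (0 : ℂ × ℂ)).eventually hf₁.eventually_analyticAt] with z hz h₀ h₁
  obtain ⟨x, y⟩ := z
  simp only at h₀ h₁
  refine (fun h : _ = (0 : ℂ) ∧ _ = (0 : ℂ) ∧ _ = (0 : ℂ) ∧ _ = (0 : ℂ) =>
    DeterminingEqs.mk h.1 h.2.1 h.2.2.1 h.2.2.2) (eq_zero_of_eventually_cubic ?_)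
  filter_upwards [hz] with p hp
  have := hp x y p rfl
  rw [fderiv_shearODE h₀.differentiableAt h₁.differentiableAt] at this
  simp only [shearODE] at this
  linear_combination this

/-! ### Germs killed by `(E - 1)(E - 2)` -/

/-- The operator `(E - 1)(E - 2)` with `E = x ∂_x + y ∂_y` the Euler field. -/
noncomputable def eulerOp (g : ℂ × ℂ → ℂ) (z : ℂ × ℂ) : ℂ :=
  z.1 ^ 2 * pdX (pdX g) z + 2 * z.1 * z.2 * pdX (pdY g) z + z.2 ^ 2 * pdY (pdY g) z
    - 2 * (z.1 * pdX g z + z.2 * pdY g z) + 2 * g z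

theorem hasDerivAt_ray {g : ℂ × ℂ → ℂ} {z : ℂ × ℂ} {t : ℂ} (hg : AnalyticAt ℂ g (t • z)) :
    HasDerivAt (fun s : ℂ => g (s • z)) (z.1 * pdX g (t • z) + z.2 * pdY g (t • z)) t := by
  have h := HasFDerivAt.comp_hasDerivAt t hg.differentiableAt.hasFDerivAt
    ((hasDerivAt_id t).smul_const z)
  rw [fderiv_apply_eq_pd, one_smul] at h
  exact h

/-- A germ killed by `(E - 1)(E - 2)` has only linear and quadratic terms. Along a ray the equation
becomes `t² φ'' - 2 t φ' + 2 φ = 0`, whose derivative is `t² φ''' = 0`. -/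
theorem eq_quadratic_of_eulerOp_eq_zero {g : ℂ × ℂ → ℂ} (hg : AnalyticAt ℂ g 0)
    (h : ∀ᶠ z in 𝓝 (0 : ℂ × ℂ), eulerOp g z = 0) :
    ∃ l₁ l₂ c₁ c₂ c₃ : ℂ, ∀ᶠ z in 𝓝 (0 : ℂ × ℂ),
      g z = l₁ * z.1 + l₂ * z.2 + c₁ * z.1 ^ 2 + c₂ * z.1 * z.2 + c₃ * z.2 ^ 2 := by
  refine ⟨pdX g 0, pdY g 0, pdX (pdX g) 0 / 2, pdX (pdY g) 0, pdY (pdY g) 0 / 2, ?_⟩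
  obtain ⟨r, hr, hb⟩ := Metric.eventually_nhds_iff_ball.1 (h.and hg.eventually_analyticAt)
  filter_upwards [Metric.ball_mem_nhds (0 : ℂ × ℂ) (half_pos hr)] with z hz
  have hz' : ∀ t ∈ Metric.ball (0 : ℂ) 2, t • z ∈ Metric.ball (0 : ℂ × ℂ) r := by
    intro t ht
    rw [mem_ball_zero_iff] at *
    rw [norm_smul]
    nlinarith [norm_nonneg z, norm_nonneg t]
  let φ : ℂ → ℂ := fun t => g (t • z)
  let φ₁ : ℂ → ℂ := fun t => z.1 * pdX g (t • z) + z.2 * pdY g (t • z)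
  let φ₂ : ℂ → ℂ := fun t => z.1 ^ 2 * pdX (pdX g) (t • z) + 2 * z.1 * z.2 * pdX (pdY g) (t • z)
    + z.2 ^ 2 * pdY (pdY g) (t • z)
  have hφ : ∀ t ∈ Metric.ball (0 : ℂ) 2, HasDerivAt φ (φ₁ t) t := fun t ht =>
    hasDerivAt_ray (hb _ (hz' t ht)).2
  have hφ₁ : ∀ t ∈ Metric.ball (0 : ℂ) 2, HasDerivAt φ₁ (φ₂ t) t := fun t ht => by
    have ha := (hb _ (hz' t ht)).2
    refine (((hasDerivAt_ray ha.pdX).const_mul z.1).fun_add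
      ((hasDerivAt_ray ha.pdY).const_mul z.2)).congr_deriv ?_
    rw [pdX_pdY_comm ha]; simp only [φ₂]; ring
  have hφ₂ : ∀ t ∈ Metric.ball (0 : ℂ) 2, AnalyticAt ℂ φ₂ t := fun t ht => by
    have ha := (hb _ (hz' t ht)).2
    have hray : AnalyticAt ℂ (fun s : ℂ => s • z) t := analyticAt_id.smul analyticAt_const
    have h1 : AnalyticAt ℂ (fun s : ℂ => pdX (pdX g) (s • z)) t :=
      AnalyticAt.comp (g := _root_.pdX (_root_.pdX g)) ha.pdX.pdX hray
    have h2 : AnalyticAt ℂ (fun s : ℂ => pdX (pdY g) (s • z)) t :=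
      AnalyticAt.comp (g := _root_.pdX (_root_.pdY g)) ha.pdY.pdX hray
    have h3 : AnalyticAt ℂ (fun s : ℂ => pdY (pdY g) (s • z)) t :=
      AnalyticAt.comp (g := _root_.pdY (_root_.pdY g)) ha.pdY.pdY hray
    fun_prop
  have hode : ∀ t ∈ Metric.ball (0 : ℂ) 2, t ^ 2 * φ₂ t - 2 * t * φ₁ t + 2 * φ t = 0 := by
    intro t ht
    have := (hb _ (hz' t ht)).1
    simp only [eulerOp, Prod.smul_fst, Prod.smul_snd, smul_eq_mul] at this
    simp only [φ, φ₁, φ₂]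
    linear_combination this
  have hev : ∀ t ∈ Metric.ball (0 : ℂ) 2, ∀ᶠ s in 𝓝 t, s ∈ Metric.ball (0 : ℂ) 2 := fun t ht =>
    Metric.isOpen_ball.mem_nhds ht
  have h3 : ∀ t ∈ Metric.ball (0 : ℂ) 2, t ^ 2 * deriv φ₂ t = 0 := by
    intro t ht
    have e1 := ((((hasDerivAt_pow 2 t).fun_mul (hφ₂ t ht).differentiableAt.hasDerivAt).fun_sub
      (((hasDerivAt_id t).const_mul 2).fun_mul (hφ₁ t ht))).fun_add ((hφ t ht).const_mul 2)).deriv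
    replace e1 := e1.symm.trans
      (EventuallyEq.deriv_eq (f := fun _ => 0) ((hev t ht).mono fun s hs => hode s hs))
    simp only [deriv_const, Nat.cast_ofNat, id_eq] at e1
    linear_combination e1
  have h4 : ∀ t ∈ Metric.ball (0 : ℂ) 2, HasDerivAt φ₂ 0 t := by
    intro t ht
    suffices deriv φ₂ t = 0 from this ▸ (hφ₂ t ht).differentiableAt.hasDerivAt
    rcases eq_or_ne t 0 with rfl | h0
    · exact (analyticAt_eventuallyEq_of_mul_left (f := deriv φ₂) (g := fun _ => 0)
        (k := fun t => t ^ 2) (hφ₂ 0 ht).deriv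
        analyticAt_const (eventually_mem_nhdsWithin.mono fun y hy => pow_ne_zero 2 hy)
        ((hev 0 ht).mono fun s hs => by rw [h3 s hs, mul_zero])).self_of_nhds
    · exact (mul_eq_zero.1 (h3 t ht)).resolve_left (pow_ne_zero 2 h0)
  have h5 : ∀ t ∈ Metric.ball (0 : ℂ) 2, φ₂ t = φ₂ 0 := fun t ht => eq_of_deriv_eq_zero_ball h4 ht
  have h6 : ∀ t ∈ Metric.ball (0 : ℂ) 2, φ₁ t - t * φ₂ 0 = φ₁ 0 - 0 * φ₂ 0 := fun t ht =>
    eq_of_deriv_eq_zero_ball (F := fun t => φ₁ t - t * φ₂ 0) (fun s hs =>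
      ((hφ₁ s hs).fun_sub ((hasDerivAt_id s).mul_const _)).congr_deriv (by rw [h5 s hs]; simp)) ht
  have h1 : (1 : ℂ) ∈ Metric.ball (0 : ℂ) 2 := by simp
  have e1 := hode 1 h1
  have e2 := h5 1 h1
  have e3 := h6 1 h1
  have e4 : φ 1 = g z := by simp [φ]
  have e5 : φ₁ 0 = z.1 * pdX g 0 + z.2 * pdY g 0 := by simp [φ₁]
  have e6 : φ₂ 0 = z.1 ^ 2 * pdX (pdX g) 0 + 2 * z.1 * z.2 * pdX (pdY g) 0
    + z.2 ^ 2 * pdY (pdY g) 0 := by simp [φ₂]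
  rw [← e4]
  linear_combination e1 / 2 - e2 / 2 + e3 + e5 + e6 / 2

/-! ### The form of a symmetry -/

/-- The function `f` has at `z` the partial derivatives `a` and `b`, as a differentiable function. -/
def HasPD (f : ℂ × ℂ → ℂ) (a b : ℂ) (z : ℂ × ℂ) : Prop :=
  HasFDerivAt f (a • ContinuousLinearMap.fst ℂ ℂ ℂ + b • ContinuousLinearMap.snd ℂ ℂ ℂ) z

namespace HasPD

variable {f g : ℂ × ℂ → ℂ} {a b a' b' : ℂ} {z : ℂ × ℂ}

theorem pdX (h : HasPD f a b z) : pdX f z = a := by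
  rw [_root_.pdX, HasFDerivAt.fderiv h]; simp

theorem pdY (h : HasPD f a b z) : pdY f z = b := by
  rw [_root_.pdY, HasFDerivAt.fderiv h]; simp

theorem of_analyticAt (h : AnalyticAt ℂ f z) : HasPD f (_root_.pdX f z) (_root_.pdY f z) z := by
  refine h.differentiableAt.hasFDerivAt.congr_fderiv ?_
  ext <;> simp [_root_.pdX, _root_.pdY]

theorem congr (h : HasPD f a b z) (ha : a = a') (hb : b = b') : HasPD f a' b' z :=
  ha ▸ hb ▸ h

theorem const (c : ℂ) (z : ℂ × ℂ) : HasPD (fun _ => c) 0 0 z := by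
  refine (hasFDerivAt_const c z).congr_fderiv ?_
  ext <;> simp

theorem fst (z : ℂ × ℂ) : HasPD (fun z => z.1) 1 0 z := by
  refine (hasFDerivAt_fst (𝕜 := ℂ) (p := z)).congr_fderiv ?_
  ext <;> simp

theorem snd (z : ℂ × ℂ) : HasPD (fun z => z.2) 0 1 z := by
  refine (hasFDerivAt_snd (𝕜 := ℂ) (p := z)).congr_fderiv ?_
  ext <;> simp

theorem comp_snd {u : ℂ → ℂ} {u' : ℂ} (h : HasDerivAt u u' z.2) :
    HasPD (fun z => u z.2) 0 u' z := by
  refine (HasDerivAt.comp_hasFDerivAt (h₂ := u) z h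
    (hasFDerivAt_snd (𝕜 := ℂ) (p := z))).congr_fderiv ?_
  ext <;> simp

theorem add (h : HasPD f a b z) (h' : HasPD g a' b' z) :
    HasPD (fun z => f z + g z) (a + a') (b + b') z := by
  refine (HasFDerivAt.fun_add h h').congr_fderiv ?_
  ext <;> simp

theorem sub (h : HasPD f a b z) (h' : HasPD g a' b' z) :
    HasPD (fun z => f z - g z) (a - a') (b - b') z := by
  refine (HasFDerivAt.fun_sub h h').congr_fderiv ?_
  ext <;> simp

theorem mul (h : HasPD f a b z) (h' : HasPD g a' b' z) :
    HasPD (fun z => f z * g z) (a * g z + f z * a') (b * g z + f z * b') z := by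
  refine (HasFDerivAt.fun_mul h h').congr_fderiv ?_
  ext <;> simp <;> ring

end HasPD

/-- The partial derivatives up to order two of the function `g` at `z`, given by formulas for the
first ones near `z` and by their own derivatives. -/
theorem pd_eq_of_hasPD {g gx gy : ℂ × ℂ → ℂ} {gxx gxy gyx gyy : ℂ} {z : ℂ × ℂ}
    (h : ∀ᶠ w in 𝓝 z, HasPD g (gx w) (gy w) w) (hx : HasPD gx gxx gyx z) (hy : HasPD gy gxy gyy z) :
    pdX g z = gx z ∧ pdY g z = gy z ∧ pdX (pdX g) z = gxx ∧ pdX (pdY g) z = gxy ∧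
      pdY (pdY g) z = gyy := by
  have h1 : pdX g =ᶠ[𝓝 z] gx := h.mono fun w hw => hw.pdX
  have h2 : pdY g =ᶠ[𝓝 z] gy := h.mono fun w hw => hw.pdY
  exact ⟨h1.self_of_nhds, h2.self_of_nhds, by rw [pdX_congr h1, hx.pdX],
    by rw [pdX_congr h2, hy.pdX], by rw [pdY_congr h2, hy.pdY]⟩

/-- The partial derivatives of `x η - y ξ`. -/
theorem pd_cross {ξ η : ℂ × ℂ → ℂ} {z : ℂ × ℂ} (hξ : AnalyticAt ℂ ξ z) (hη : AnalyticAt ℂ η z) :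
    let q : ℂ × ℂ → ℂ := fun z => z.1 * η z - z.2 * ξ z
    pdX q z = η z + z.1 * pdX η z - z.2 * pdX ξ z ∧
    pdY q z = z.1 * pdY η z - ξ z - z.2 * pdY ξ z ∧
    pdX (pdX q) z = 2 * pdX η z + z.1 * pdX (pdX η) z - z.2 * pdX (pdX ξ) z ∧
    pdX (pdY q) z = pdY η z + z.1 * pdX (pdY η) z - pdX ξ z - z.2 * pdX (pdY ξ) z ∧
    pdY (pdY q) z = z.1 * pdY (pdY η) z - 2 * pdY ξ z - z.2 * pdY (pdY ξ) z := by
  intro q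
  refine pd_eq_of_hasPD (gx := fun z => η z + z.1 * pdX η z - z.2 * pdX ξ z)
    (gy := fun z => z.1 * pdY η z - ξ z - z.2 * pdY ξ z)
    (gyx := pdY η z + z.1 * pdX (pdY η) z - pdX ξ z - z.2 * pdX (pdY ξ) z) ?_ ?_ ?_
  · filter_upwards [hξ.eventually_analyticAt, hη.eventually_analyticAt] with w h1 h2
    exact (((HasPD.fst w).mul (.of_analyticAt h2)).sub
      ((HasPD.snd w).mul (.of_analyticAt h1))).congr (by ring) (by ring)
  · refine (((HasPD.of_analyticAt hη).add ((HasPD.fst z).mul (.of_analyticAt hη.pdX))).sub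
      ((HasPD.snd z).mul (.of_analyticAt hξ.pdX))).congr (by ring) ?_
    rw [pdX_pdY_comm hξ, pdX_pdY_comm hη]; ring
  · exact ((((HasPD.fst z).mul (.of_analyticAt hη.pdY)).sub (.of_analyticAt hξ)).sub
      ((HasPD.snd z).mul (.of_analyticAt hξ.pdY))).congr (by ring) (by ring)

theorem pd_quadratic (l₁ l₂ c₁ c₂ c₃ : ℂ) (z : ℂ × ℂ) :
    let q : ℂ × ℂ → ℂ :=
      fun z => l₁ * z.1 + l₂ * z.2 + c₁ * z.1 ^ 2 + c₂ * z.1 * z.2 + c₃ * z.2 ^ 2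
    pdX q z = l₁ + 2 * c₁ * z.1 + c₂ * z.2 ∧ pdY q z = l₂ + c₂ * z.1 + 2 * c₃ * z.2 ∧
    pdX (pdX q) z = 2 * c₁ ∧ pdX (pdY q) z = c₂ ∧ pdY (pdY q) z = 2 * c₃ := by
  intro q
  have lin : ∀ (a b c : ℂ) (w : ℂ × ℂ), HasPD (fun z => a + b * z.1 + c * z.2) b c w :=
    fun a b c w => (((HasPD.const a w).add ((HasPD.const b w).mul (.fst w))).add
      ((HasPD.const c w).mul (.snd w))).congr (by ring) (by ring)
  refine pd_eq_of_hasPD (gx := fun z => l₁ + 2 * c₁ * z.1 + c₂ * z.2)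
    (gy := fun z => l₂ + c₂ * z.1 + 2 * c₃ * z.2) (gyx := c₂) ?_ (lin _ _ _ z) (lin _ _ _ z)
  refine Eventually.of_forall fun w => ?_
  have h : HasPD (fun z => (l₁ + c₁ * z.1 + c₂ * z.2) * z.1 + (l₂ + 0 * z.1 + c₃ * z.2) * z.2) _ _ w :=
    ((lin l₁ c₁ c₂ w).mul (.fst w)).add ((lin l₂ 0 c₃ w).mul (.snd w))
  have e : q = fun z => (l₁ + c₁ * z.1 + c₂ * z.2) * z.1 + (l₂ + 0 * z.1 + c₃ * z.2) * z.2 := by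
    funext z; simp only [q]; ring
  rw [e]
  exact h.congr (by ring) (by ring)

theorem eventually_eq_of_snd_mul {f g : ℂ × ℂ → ℂ} (hf : AnalyticAt ℂ f 0) (hg : AnalyticAt ℂ g 0)
    (h : ∀ᶠ z in 𝓝 (0 : ℂ × ℂ), z.2 * f z = z.2 * g z) : ∀ᶠ z in 𝓝 (0 : ℂ × ℂ), f z = g z := by
  filter_upwards [hf.eventually_analyticAt, hg.eventually_analyticAt, h.eventually_nhds]
    with z h1 h2 h3
  obtain ⟨x, y⟩ := z
  rcases eq_or_ne y 0 with rfl | hy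
  · have hc : AnalyticAt ℂ (fun y : ℂ => (x, y)) 0 := analyticAt_const.prod analyticAt_id
    have hc' : Tendsto (fun y : ℂ => (x, y)) (𝓝 0) (𝓝 (x, 0)) := hc.continuousAt
    exact (analyticAt_eventuallyEq_of_id_mul (AnalyticAt.comp (g := f) h1 hc)
      (AnalyticAt.comp (g := g) h2 hc) (hc'.eventually h3)).self_of_nhds
  · exact mul_left_cancel₀ hy h3.self_of_nhds

/-- The form of a symmetry. First `x η - y ξ` is a quadratic polynomial; then `η` solves the
inhomogeneous equation `(E - 1)(E - 2) η = 2 b₁ + 2 y² f₁ (b₀ y + b₁ x)`, a particular solution of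
which is `b₁ + (b₀ y + b₁ x) M(y)` with `M'' = 2 f₁`. Here `M = y N`. -/
theorem exists_symmetry_form {f₀ f₁ : ℂ → ℂ} (hf₁ : AnalyticAt ℂ f₁ 0) {ξ η : ℂ × ℂ → ℂ}
    (hξ : AnalyticAt ℂ ξ 0) (hη : AnalyticAt ℂ η 0)
    (hD : ∀ᶠ z in 𝓝 (0 : ℂ × ℂ), DeterminingEqs f₀ f₁ ξ η z.1 z.2) :
    ∃ (b₀ b₁ a₀ a₁ l₁ l₂ c₁ c₀ : ℂ) (N : ℂ → ℂ), AnalyticAt ℂ N 0 ∧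
      (∀ᶠ y in 𝓝 (0 : ℂ), deriv (deriv fun y => y * N y) y = 2 * f₁ y) ∧
      b₀ = -ξ 0 ∧ b₁ = η 0 ∧ l₁ = pdX η 0 ∧
      (∀ᶠ z in 𝓝 (0 : ℂ × ℂ), ξ z = (-b₀ + a₀ * z.2)
        + (a₁ + l₂ + c₀ * z.2 + b₀ * (z.2 * N z.2)) * z.1 + (c₁ + b₁ * N z.2) * z.1 ^ 2) ∧
      (∀ᶠ z in 𝓝 (0 : ℂ × ℂ), η z
        = (b₁ + z.2 * (l₂ + c₀ * z.2 + b₀ * (z.2 * N z.2)))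
          + (l₁ + c₁ * z.2 + b₁ * (z.2 * N z.2)) * z.1) := by
  let q : ℂ × ℂ → ℂ := fun z => z.1 * η z - z.2 * ξ z
  have hq : AnalyticAt ℂ q 0 := (analyticAt_fst.mul hη).sub (analyticAt_snd.mul hξ)
  have dξ := hξ.eventually_analyticAt
  have dη := hη.eventually_analyticAt
  obtain ⟨b₁, b₀, d₂, d₁, d₀, hquad⟩ := eq_quadratic_of_eulerOp_eq_zero hq (by
    filter_upwards [hD, dξ, dη] with z D h1 h2
    obtain ⟨x, y⟩ := z
    obtain ⟨e1, e2, e3, e4, e5⟩ := pd_cross h1 h2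
    change pdX q _ = _ at e1
    change pdY q _ = _ at e2
    change pdX (pdX q) _ = _ at e3
    change pdX (pdY q) _ = _ at e4
    change pdY (pdY q) _ = _ at e5
    rw [eulerOp, e1, e2, e3, e4, e5]
    simp only [q]
    -- The cubic form vanishes at `p = y / x`, that is, at `y - x p = 0`, because the lines through
    -- the origin are solutions.
    linear_combination x ^ 3 * D.eq₀ + x ^ 2 * y * D.eq₁ + x * y ^ 2 * D.eq₂ + y ^ 3 * D.eq₃)
  have hrel : ∀ᶠ z in 𝓝 (0 : ℂ × ℂ),
      (η z + z.1 * pdX η z - z.2 * pdX ξ z = b₁ + 2 * d₂ * z.1 + d₁ * z.2) ∧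
      (z.1 * pdY η z - ξ z - z.2 * pdY ξ z = b₀ + d₁ * z.1 + 2 * d₀ * z.2) ∧
      (2 * pdX η z + z.1 * pdX (pdX η) z - z.2 * pdX (pdX ξ) z = 2 * d₂) ∧
      (pdY η z + z.1 * pdX (pdY η) z - pdX ξ z - z.2 * pdX (pdY ξ) z = d₁) := by
    filter_upwards [hquad.eventually_nhds.eventually_nhds, dξ, dη] with z h h1 h2
    obtain ⟨e1, e2, e3, e4, -⟩ := pd_cross h1 h2
    obtain ⟨e1', e2', e3', e4', -⟩ := pd_quadratic b₁ b₀ d₂ d₁ d₀ z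
    have h' : ∀ᶠ w in 𝓝 z, q =ᶠ[𝓝 w] _ := h
    refine ⟨e1.symm.trans ((pdX_congr h'.self_of_nhds).trans e1'),
      e2.symm.trans ((pdY_congr h'.self_of_nhds).trans e2'),
      e3.symm.trans ((pdX_congr (h'.mono fun w hw => pdX_congr hw)).trans e3'),
      e4.symm.trans ((pdX_congr (h'.mono fun w hw => pdY_congr hw)).trans e4')⟩
  obtain ⟨F, hF, -, hF'⟩ := exists_analyticAt_primitive
    ((analyticAt_const (v := (2 : ℂ))).mul hf₁)
  obtain ⟨M, hM, hM0, hM'⟩ := exists_analyticAt_primitive hF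
  obtain ⟨N, hN, hMN⟩ := exists_eq_add_id_mul hM
  obtain rfl : M = fun y => y * N y := by funext y; rw [hMN y, hM0, zero_add]
  set M : ℂ → ℂ := fun y => y * N y
  have snd_ev : ∀ {P : ℂ → Prop}, (∀ᶠ y in 𝓝 (0 : ℂ), P y) → ∀ᶠ z in 𝓝 (0 : ℂ × ℂ), P z.2 :=
    fun hP => (continuous_snd.tendsto (0 : ℂ × ℂ)).eventually hP
  have snd_an : ∀ {u : ℂ → ℂ}, AnalyticAt ℂ u 0 → AnalyticAt ℂ (fun z : ℂ × ℂ => u z.2) 0 :=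
    fun {u} hu => AnalyticAt.comp (g := u) (f := Prod.snd) (x := (0 : ℂ × ℂ)) hu analyticAt_snd
  let g : ℂ × ℂ → ℂ := fun z => η z - b₁ - (b₀ * z.2 + b₁ * z.1) * M z.2
  have hg : AnalyticAt ℂ g 0 := (hη.sub analyticAt_const).sub
    (((analyticAt_const.mul analyticAt_snd).add (analyticAt_const.mul analyticAt_fst)).mul
      (snd_an hM))
  obtain ⟨l₁, l₂, c₂, c₁, c₀, hgq⟩ := eq_quadratic_of_eulerOp_eq_zero hg (by
    have hgpd : ∀ᶠ w in 𝓝 (0 : ℂ × ℂ), HasPD g (pdX η w - b₁ * M w.2)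
        (pdY η w - b₀ * M w.2 - (b₀ * w.2 + b₁ * w.1) * F w.2) w := by
      filter_upwards [dη, snd_ev hM'] with w h1 h2
      exact (((HasPD.of_analyticAt h1).sub (.const b₁ w)).sub
        ((((HasPD.const b₀ w).mul (.snd w)).add ((HasPD.const b₁ w).mul (.fst w))).mul
          (.comp_snd h2))).congr (by ring) (by ring)
    filter_upwards [hD, dξ, dη, hrel, hgpd.eventually_nhds, snd_ev hM', snd_ev hF', hquad]
      with z D h1 h2 h3 h4 h5 h6 h7
    obtain ⟨e1, e2, e3, e4, e5⟩ := pd_eq_of_hasPD h4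
      ((HasPD.of_analyticAt h2.pdX).sub ((HasPD.const b₁ z).mul (.comp_snd h5)))
      (((HasPD.of_analyticAt h2.pdY).sub ((HasPD.const b₀ z).mul (.comp_snd h5))).sub
        ((((HasPD.const b₀ z).mul (.snd z)).add ((HasPD.const b₁ z).mul (.fst z))).mul
          (.comp_snd h6)))
    rw [eulerOp, e1, e2, e3, e4, e5]
    obtain ⟨x, y⟩ := z
    obtain ⟨r1, r2, r3, r4⟩ := h3
    simp only [g, q, Pi.mul_apply] at r1 r2 r3 r4 h7 ⊢
    -- The derivative of the cubic form at `p = y / x`, simplified by what is known of `x η - y ξ`.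
    linear_combination 3 * x ^ 2 * D.eq₀ + 2 * x * y * D.eq₁ + y ^ 2 * D.eq₂
      + (-2 * x) * r3 - 2 * y * r4 + 2 * r1
      + 2 * y ^ 2 * f₁ y * (2 * h7 - x * r1 - y * r2))
  have hb₁ : η 0 = b₁ := by simpa [g, hM0, sub_eq_zero] using hgq.self_of_nhds
  obtain ⟨-, hb₀, hd₂, -⟩ := hrel.self_of_nhds
  simp only [Prod.fst_zero, Prod.snd_zero, zero_mul, mul_zero, zero_sub, sub_zero, add_zero] at hb₀ hd₂
  -- On the line `y = 0` only `x η` survives in `x η - y ξ`.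
  have hline : ∀ᶠ x in 𝓝 (0 : ℂ), 0 + 0 * x + (l₁ - d₂) * x ^ 2 + c₂ * x ^ 3 = 0 := by
    have ht : Tendsto (fun x : ℂ => (x, (0 : ℂ))) (𝓝 0) (𝓝 (0 : ℂ × ℂ)) :=
      Continuous.tendsto (by fun_prop) _
    filter_upwards [ht.eventually hquad, ht.eventually hgq] with x h1 h2
    simp only [q, g] at h1 h2
    rw [hM0] at h2
    linear_combination h1 - x * h2
  obtain ⟨-, -, hl₁, hc₂⟩ := eq_zero_of_eventually_cubic hline
  have hηform : ∀ᶠ z in 𝓝 (0 : ℂ × ℂ), η z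
        = (b₁ + z.2 * (l₂ + c₀ * z.2 + b₀ * (z.2 * N z.2)))
          + (l₁ + c₁ * z.2 + b₁ * (z.2 * N z.2)) * z.1 := by
    filter_upwards [hgq] with z h1
    simp only [g, M] at h1
    linear_combination h1 + z.1 ^ 2 * hc₂
  refine ⟨b₀, b₁, -d₀, -d₁, l₁, l₂, c₁, c₀, N, hN, ?_, hb₀.symm, hb₁.symm,
    by linear_combination hl₁ - hd₂ / 2, ?_, hηform⟩
  · filter_upwards [hM'.eventually_nhds, hF'] with y h1 h2
    have h3 : deriv M =ᶠ[𝓝 y] F := h1.mono fun w hw => hw.deriv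
    rw [h3.deriv_eq, h2.deriv]
    rfl
  · have hN2 := snd_an hN
    have hfst : AnalyticAt ℂ (fun z : ℂ × ℂ => z.1) 0 := analyticAt_fst
    have hsnd : AnalyticAt ℂ (fun z : ℂ × ℂ => z.2) 0 := analyticAt_snd
    refine eventually_eq_of_snd_mul hξ (by fun_prop) ?_
    filter_upwards [hquad, hηform] with z h1 h2
    simp only [q] at h1
    linear_combination z.1 * h2 - h1 + z.1 ^ 2 * hl₁

/-- The coefficients of `1` and `x` in the first two determining equations, for a vector field with
components `ξ = A + B x + C x²` and `η = P + Q x`, whose coefficients depend on `y` only. -/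
theorem coefficient_equations {f₀ f₁ : ℂ → ℂ} {ξ η : ℂ × ℂ → ℂ} {A B C P Q : ℂ → ℂ}
    (hA : AnalyticAt ℂ A 0) (hB : AnalyticAt ℂ B 0) (hC : AnalyticAt ℂ C 0)
    (hP : AnalyticAt ℂ P 0) (hQ : AnalyticAt ℂ Q 0)
    (hξ : ∀ᶠ z in 𝓝 (0 : ℂ × ℂ), ξ z = A z.2 + B z.2 * z.1 + C z.2 * z.1 ^ 2)
    (hη : ∀ᶠ z in 𝓝 (0 : ℂ × ℂ), η z = P z.2 + Q z.2 * z.1)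
    (hD : ∀ᶠ z in 𝓝 (0 : ℂ × ℂ), DeterminingEqs f₀ f₁ ξ η z.1 z.2) :
    ∀ᶠ y in 𝓝 (0 : ℂ),
      ((deriv P y - 2 * B y) * (f₀ y * y ^ 3) - P y * (3 * y ^ 2 * f₀ y + y ^ 3 * deriv f₀ y)
        - Q y * (y ^ 2 * f₁ y) = 0) ∧
      ((deriv Q y - 4 * C y) * (f₀ y * y ^ 3) - Q y * (y ^ 3 * deriv f₀ y) = 0) ∧
      (2 * deriv Q y - 2 * C y - B y * (y ^ 2 * f₁ y) - 3 * deriv A y * (f₀ y * y ^ 3)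
        + 3 * f₀ y * y ^ 2 * A y - P y * (2 * y * f₁ y + y ^ 2 * deriv f₁ y) = 0) ∧
      (-2 * C y * (y ^ 2 * f₁ y) + 6 * B y * (y ^ 2 * f₀ y) - 3 * deriv B y * (f₀ y * y ^ 3)
        + 3 * P y * (2 * y * f₀ y + y ^ 2 * deriv f₀ y)
        - Q y * (y ^ 2 * deriv f₁ y - 2 * y * f₁ y) = 0) := by
  have hswap : Tendsto (fun w : ℂ × ℂ => (w.2, w.1)) (𝓝 0 ×ˢ 𝓝 0) (𝓝 (0 : ℂ × ℂ)) := by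
    rw [← nhds_prod_eq]
    exact (Continuous.tendsto (by fun_prop) _)
  have key := (hswap.eventually (hD.and (hξ.eventually_nhds.and hη.eventually_nhds))).curry
  filter_upwards [key, hA.eventually_analyticAt, hB.eventually_analyticAt,
    hC.eventually_analyticAt, hP.eventually_analyticAt, hQ.eventually_analyticAt]
    with y hy hA hB hC hP hQ
  have pd : ∀ᶠ x in 𝓝 (0 : ℂ), DeterminingEqs f₀ f₁ ξ η x y ∧
      ξ (x, y) = A y + B y * x + C y * x ^ 2 ∧ η (x, y) = P y + Q y * x ∧
      pdX ξ (x, y) = B y + 2 * C y * x ∧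
      pdY ξ (x, y) = deriv A y + deriv B y * x + deriv C y * x ^ 2 ∧
      pdX (pdX ξ) (x, y) = 2 * C y ∧
      pdX η (x, y) = Q y ∧ pdY η (x, y) = deriv P y + deriv Q y * x ∧
      pdX (pdX η) (x, y) = 0 ∧ pdX (pdY η) (x, y) = deriv Q y := by
    filter_upwards [hy] with x hx
    obtain ⟨hD, hξ, hη⟩ := hx
    have snd_ev : ∀ {R : ℂ → Prop}, (∀ᶠ t in 𝓝 y, R t) → ∀ᶠ z in 𝓝 ((x, y) : ℂ × ℂ), R z.2 :=
      fun hR => (continuous_snd.tendsto ((x, y) : ℂ × ℂ)).eventually hR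
    have cs : ∀ {u : ℂ → ℂ} {w : ℂ × ℂ}, AnalyticAt ℂ u w.2 →
        HasPD (fun z => u z.2) 0 (deriv u w.2) w :=
      fun hu => .comp_snd hu.differentiableAt.hasDerivAt
    have e1 : ξ =ᶠ[𝓝 (x, y)] fun z => A z.2 + B z.2 * z.1 + C z.2 * (z.1 * z.1) :=
      hξ.mono fun z hz => by rw [hz]; ring
    have e2 : η =ᶠ[𝓝 (x, y)] fun z => P z.2 + Q z.2 * z.1 := hη
    have p1 : ∀ᶠ w in 𝓝 ((x, y) : ℂ × ℂ),
        HasPD (fun z => A z.2 + B z.2 * z.1 + C z.2 * (z.1 * z.1))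
          (B w.2 + 2 * (C w.2 * w.1))
          (deriv A w.2 + deriv B w.2 * w.1 + deriv C w.2 * (w.1 * w.1)) w := by
      filter_upwards [snd_ev hA.eventually_analyticAt, snd_ev hB.eventually_analyticAt,
        snd_ev hC.eventually_analyticAt] with w hA hB hC
      exact (((cs hA).add ((cs hB).mul (.fst w))).add
        ((cs hC).mul ((HasPD.fst w).mul (.fst w)))).congr (by ring) (by ring)
    have p2 : ∀ᶠ w in 𝓝 ((x, y) : ℂ × ℂ),
        HasPD (fun z => P z.2 + Q z.2 * z.1) (Q w.2) (deriv P w.2 + deriv Q w.2 * w.1) w := by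
      filter_upwards [snd_ev hP.eventually_analyticAt, snd_ev hQ.eventually_analyticAt] with w hP hQ
      exact ((cs hP).add ((cs hQ).mul (.fst w))).congr (by ring) (by ring)
    have hx : ∀ᶠ w in 𝓝 ((x, y) : ℂ × ℂ), pdX ξ w = B w.2 + 2 * (C w.2 * w.1) := by
      filter_upwards [e1.eventually_nhds, p1] with w h1 h2
      rw [pdX_congr h1, h2.pdX]
    have hηx : ∀ᶠ w in 𝓝 ((x, y) : ℂ × ℂ), pdX η w = Q w.2 := by
      filter_upwards [e2.eventually_nhds, p2] with w h1 h2
      rw [pdX_congr h1, h2.pdX]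
    have hηy : ∀ᶠ w in 𝓝 ((x, y) : ℂ × ℂ), pdY η w = deriv P w.2 + deriv Q w.2 * w.1 := by
      filter_upwards [e2.eventually_nhds, p2] with w h1 h2
      rw [pdY_congr h1, h2.pdY]
    refine ⟨hD, hξ.self_of_nhds, hη.self_of_nhds, ?_, ?_, ?_, hηx.self_of_nhds, hηy.self_of_nhds,
      ?_, ?_⟩
    · rw [hx.self_of_nhds]; ring
    · rw [pdY_congr e1, p1.self_of_nhds.pdY]; ring
    · rw [pdX_congr hx, ((cs (w := (x, y)) hB).add ((HasPD.const 2 (x, y)).mul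
        ((cs (w := (x, y)) hC).mul (.fst (x, y))))).pdX]
      ring
    · rw [pdX_congr hηx, (cs (w := (x, y)) hQ).pdX]
    · rw [pdX_congr hηy, ((cs (w := (x, y)) hP.deriv).add ((cs (w := (x, y)) hQ.deriv).mul
        (.fst (x, y)))).pdX]
      ring
  have h₀ := eq_zero_of_eventually_cubic
    (c₀ := (deriv P y - 2 * B y) * (f₀ y * y ^ 3) - P y * (3 * y ^ 2 * f₀ y + y ^ 3 * deriv f₀ y)
      - Q y * (y ^ 2 * f₁ y))
    (c₁ := (deriv Q y - 4 * C y) * (f₀ y * y ^ 3) - Q y * (y ^ 3 * deriv f₀ y)) (c₂ := 0) (c₃ := 0)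
    (pd.mono fun x hx => by
      obtain ⟨D, h1, h2, h3, h4, h5, h6, h7, h8, h9⟩ := hx
      have := D.eq₀
      rw [h2, h3, h6, h7, h8] at this
      linear_combination this)
  have h₁ := eq_zero_of_eventually_cubic
    (c₀ := 2 * deriv Q y - 2 * C y - B y * (y ^ 2 * f₁ y) - 3 * deriv A y * (f₀ y * y ^ 3)
      + 3 * f₀ y * y ^ 2 * A y - P y * (2 * y * f₁ y + y ^ 2 * deriv f₁ y))
    (c₁ := -2 * C y * (y ^ 2 * f₁ y) + 6 * B y * (y ^ 2 * f₀ y) - 3 * deriv B y * (f₀ y * y ^ 3)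
      + 3 * P y * (2 * y * f₀ y + y ^ 2 * deriv f₀ y)
      - Q y * (y ^ 2 * deriv f₁ y - 2 * y * f₁ y))
    (c₂ := 9 * C y * (y ^ 2 * f₀ y) - 3 * deriv C y * (f₀ y * y ^ 3)
      + 3 * Q y * (y ^ 2 * deriv f₀ y)) (c₃ := 0)
    (pd.mono fun x hx => by
      obtain ⟨D, h1, h2, h3, h4, h5, h6, h7, h8, h9⟩ := hx
      have := D.eq₁
      rw [h1, h2, h3, h4, h5, h6, h9] at this
      linear_combination this)
  exact ⟨h₀.1, h₀.2.1, h₁.1, h₁.2.1⟩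

/-! ### From symmetries to normal forms -/

theorem deriv_const_add_id_mul {G : ℂ → ℂ} {y : ℂ} (hG : AnalyticAt ℂ G y) (c : ℂ) :
    deriv (fun y => c + y * G y) y = G y + y * deriv G y := by
  have := ((hasDerivAt_id y).fun_mul hG.differentiableAt.hasDerivAt).const_add c
  simpa using this.deriv

theorem deriv_deriv_affine_add {M : ℂ → ℂ} {y : ℂ} (hM : AnalyticAt ℂ M y) (l c b : ℂ) :
    deriv (deriv fun y => l + c * y + b * M y) y = b * deriv (deriv M) y := by
  have h : deriv (fun y => l + c * y + b * M y) =ᶠ[𝓝 y] fun y => c + b * deriv M y := by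
    filter_upwards [hM.eventually_analyticAt] with w hw
    have := (((hasDerivAt_id w).const_mul c).const_add l).fun_add
      (hw.differentiableAt.hasDerivAt.const_mul b)
    simpa using this.deriv
  rw [h.deriv_eq]
  simp

/-- A symmetry `ξ ∂_x + η ∂_y` gives an affine one: the commutator with the shear in general, and
the symmetry itself, up to the shear, if `η` vanishes at the origin but `ξ` does not. -/
theorem exists_affineSymmetry {f₀ f₁ : ℂ → ℂ} (hf₀ : AnalyticAt ℂ f₀ 0) (hf₁ : AnalyticAt ℂ f₁ 0)
    (hf : ¬ ((∀ᶠ y in 𝓝 (0 : ℂ), f₀ y = 0) ∧ ∀ᶠ y in 𝓝 (0 : ℂ), f₁ y = 0))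
    {ξ η : ℂ × ℂ → ℂ} (hξ : AnalyticAt ℂ ξ 0) (hη : AnalyticAt ℂ η 0)
    (hD : ∀ᶠ z in 𝓝 (0 : ℂ × ℂ), DeterminingEqs f₀ f₁ ξ η z.1 z.2) :
    (∃ e, AffineSymmetry f₀ f₁ e (-2 * pdX η 0) (η 0) ∧ e 0 = pdX η 0) ∧
      (η 0 = 0 → ξ 0 ≠ 0 → ∃ e a, AffineSymmetry f₀ f₁ e a (-ξ 0)) := by
  obtain ⟨b₀, b₁, a₀, a₁, l₁, l₂, c₁, c₀, N, hN, hM, hb₀, hb₁, hl₁, hξ', hη'⟩ :=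
    exists_symmetry_form hf₁ hξ hη hD
  rw [← hb₀, ← hb₁, ← hl₁]
  set M : ℂ → ℂ := fun y => y * N y
  have hMan : AnalyticAt ℂ M 0 := analyticAt_id.mul hN
  set G : ℂ → ℂ := fun y => l₂ + c₀ * y + b₀ * M y with hGdef
  have hG : AnalyticAt ℂ G 0 := by fun_prop
  set C : ℂ → ℂ := fun y => c₁ + b₁ * N y
  have hC : AnalyticAt ℂ C 0 := by fun_prop
  have E := coefficient_equations (A := fun y => -b₀ + a₀ * y) (B := fun y => a₁ + G y) (C := C)
    (P := fun y => b₁ + y * G y) (Q := fun y => l₁ + y * C y) (by fun_prop) (by fun_prop) hC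
    (by fun_prop) (by fun_prop)
    (hξ'.mono fun z hz => by rw [hz]; simp only [G, M, C]; ring)
    (hη'.mono fun z hz => by rw [hz]; simp only [G, M, C]; ring) hD
  have dA : ∀ y : ℂ, deriv (fun y => -b₀ + a₀ * y) y = a₀ := fun y => by simp
  have dB : ∀ y : ℂ, deriv (fun y => a₁ + G y) y = deriv G y := fun y => by simp
  have hCq : ∀ y, l₁ + y * C y = l₁ + c₁ * y + b₁ * M y := fun y => by simp only [C, M]; ring
  have S₁ : AffineSymmetry f₀ f₁ (fun y => l₁ + y * C y) (-2 * l₁) b₁ := by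
    refine ⟨hf₀, hf₁, by fun_prop, ?_, ?_, ?_⟩
    · filter_upwards [hM, hMan.eventually_analyticAt] with y h1 h2
      simp only [hCq]
      rw [deriv_deriv_affine_add h2, h1]
      ring
    · have hf₁' := hf₁.deriv
      refine analyticAt_eventually_zero_of_pow_mul (by fun_prop) 2 ?_
      filter_upwards [E, hG.eventually_analyticAt] with y ⟨E₁, _, _, E₄⟩ hG
      rw [dB] at E₄
      rw [deriv_const_add_id_mul hG] at E₁
      linear_combination -3 * E₁ - y * E₄
    · have hf₀' := hf₀.deriv
      have hQ : AnalyticAt ℂ (fun y => l₁ + y * C y) 0 := by fun_prop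
      have hQ' := hQ.deriv
      refine (analyticAt_eventually_zero_of_pow_mul (g := fun y =>
        y * (l₁ + y * C y) * deriv f₀ y
          - (y * deriv (fun y => l₁ + y * C y) y - 4 * (l₁ + y * C y) - 2 * (-2 * l₁)) * f₀ y)
        (by fun_prop) 2 ?_).mono fun y hy => by linear_combination hy
      filter_upwards [E] with y ⟨_, E₂, _, _⟩
      linear_combination -E₂
  refine ⟨⟨_, S₁, by simp⟩, fun hb hb' => ?_⟩
  have hb₀' : b₀ ≠ 0 := by rw [hb₀]; exact neg_ne_zero.2 hb'
  subst hb
  have hCc : ∀ y, C y = c₁ := fun y => by simp [C]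
  have dQ : ∀ y, deriv (fun y => l₁ + y * C y) y = c₁ := fun y => by simp [hCc]
  -- The remaining part concerns the symmetry itself: `b₁ = 0` and the order of vanishing of `f₁`
  -- force `Q = l₁ + c₁ y` to be zero, so that the symmetry is affine in `x`.
  have hne : ¬ ∀ᶠ y in 𝓝 (0 : ℂ), f₁ y = 0 := by
    intro h
    refine hf ⟨analyticAt_eventually_zero_of_pow_mul hf₀ 2 ?_, h⟩
    filter_upwards [E, h.eventually_nhds] with y ⟨_, _, E₃, _⟩ h1
    have h2 : deriv f₁ y = 0 := by
      rw [EventuallyEq.deriv_eq (f := fun _ => 0) h1]; simp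
    rw [dA, dQ, hCc, h1.self_of_nhds, h2] at E₃
    refine (mul_eq_zero.1 (?_ : b₀ * (y ^ 2 * f₀ y) = 0)).resolve_left hb₀'
    linear_combination -E₃ / 3
  have hl : l₁ = 0 := by
    have h : ∀ᶠ y in 𝓝 (0 : ℂ), y * (l₁ + c₁ * y) * deriv f₁ y = -(l₁ + 3 * c₁ * y) * f₁ y := by
      filter_upwards [S₁.eq₁] with y hy
      rw [hCc] at hy
      linear_combination hy
    rcases eventually_eq_zero_or_order_eq hf₁ (by fun_prop) (by fun_prop) h with
      h | ⟨n, _, _, _, _, hn⟩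
    · exact absurd h hne
    · refine (mul_eq_zero.1 (?_ : ((n + 1 : ℕ) : ℂ) * l₁ = 0)).resolve_left
        (Nat.cast_ne_zero.2 n.succ_ne_zero)
      push_cast
      linear_combination hn
  have hc : c₁ = 0 := by
    by_contra hc
    have hf₁' := hf₁.deriv
    have h := analyticAt_eventually_zero_of_pow_mul (g := fun y => 3 * f₁ y + y * deriv f₁ y)
      (by fun_prop) 1 (by
        filter_upwards [S₁.eq₁] with y hy
        rw [hCc, hl] at hy
        refine (mul_eq_zero.1 (?_ : c₁ * _ = 0)).resolve_left hc
        linear_combination hy)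
    refine hne (eventually_eq_zero_of_euler_eq_zero (n := 3) (by norm_num) hf₁ ?_)
    filter_upwards [h] with y hy
    push_cast
    linear_combination hy
  refine ⟨G, a₁, hf₀, hf₁, hG, ?_, ?_, ?_⟩
  · filter_upwards [hM, hMan.eventually_analyticAt] with y h1 h2
    rw [hGdef, deriv_deriv_affine_add h2, h1]
    ring
  · have hf₁' := hf₁.deriv
    refine analyticAt_eventually_zero_of_pow_mul (by fun_prop) 2 ?_
    filter_upwards [E] with y ⟨_, _, E₃, _⟩
    rw [dA, dQ, hCc, hc] at E₃
    linear_combination -E₃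
  · have hf₀' := hf₀.deriv
    have hG' := hG.deriv
    refine (analyticAt_eventually_zero_of_pow_mul (g := fun y =>
      y * G y * deriv f₀ y - (y * deriv G y - 4 * G y - 2 * a₁) * f₀ y)
      (by fun_prop) 3 ?_).mono fun y hy => by linear_combination hy
    filter_upwards [E, hG.eventually_analyticAt] with y ⟨E₁, _, _, _⟩ h1
    rw [deriv_const_add_id_mul h1, hCc, hc, hl] at E₁
    linear_combination -E₁

theorem prolong_zero_of_eq_zero {V : ℂ × ℂ → ℂ × ℂ} (hV : AnalyticAt ℂ V 0) (h0 : V 0 = 0) :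
    prolong V 0 = (0, 0, pdX (fun z => (V z).2) 0) := by
  have hb : basePt 0 = 0 := rfl
  have h := hV.differentiableAt.hasFDerivAt.snd.fderiv
  simp only [prolong, hb, h0, planeDeriv, pdX, h]
  simp

theorem mainTheorem4 (f₀ f₁ : ℂ → ℂ) (hf₀ : AnalyticAt ℂ f₀ 0) (hf₁ : AnalyticAt ℂ f₁ 0)
    (hf : ¬ (f₀ =ᶠ[𝓝 0] 0 ∧ f₁ =ᶠ[𝓝 0] 0))
    (V : ℂ × ℂ → ℂ × ℂ) (hV : IsInfinitesimalSymmetry (shearODE f₀ f₁) V)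
    (hiso : ¬ IsIsotropic V) :
    (V 0 ≠ 0 →
      (∃ j : ℕ, ∀ c : ℂ, c ≠ 0 →
        ODEEquivalent (shearODE f₀ f₁) (xShift c (firstSeries j))) ∨
      (∃ (j : ℕ) (C : ℂ), ∀ c : ℂ, c ≠ 0 →
        ODEEquivalent (shearODE f₀ f₁) (xShift c (secondSeries j C)))) ∧
    (V 0 = 0 → ODEEquivalent (shearODE f₀ f₁) (xShift 0 (firstSeries 0))) := by
  have hξ : AnalyticAt ℂ (fun z => (V z).1) 0 := analyticAt_fst.comp hV.1
  have hη : AnalyticAt ℂ (fun z => (V z).2) 0 := analyticAt_snd.comp hV.1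
  obtain ⟨⟨e, S, he⟩, hS⟩ :=
    exists_affineSymmetry hf₀ hf₁ hf hξ hη (eventually_determiningEqs hf₀ hf₁ hV)
  constructor
  · intro h0
    by_cases hb : (V 0).2 = 0
    · have ha : (V 0).1 ≠ 0 := fun ha => h0 (Prod.ext ha hb)
      obtain ⟨e', a, S'⟩ := hS hb ha
      exact S'.odeEquivalent_series (neg_ne_zero.2 ha) hf
    · exact S.odeEquivalent_series hb hf
  · intro h0
    have hl : pdX (fun z => (V z).2) 0 ≠ 0 := fun hl =>
      hiso (by rw [IsIsotropic, prolong_zero_of_eq_zero hV.1 h0, hl]; rfl)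
    have hb : (V 0).2 = 0 := by rw [h0]; rfl
    rw [hb] at S
    exact S.odeEquivalent_sl2 (he.trans_ne hl) (by rw [he]) hf
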